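/- Let $Q\subset\mathbb{R}^3$ be a compact embedded $C^1$ surface with boundary, let $\mathbb{D}\subset\mathbb{R}^2$ be the closed unit disk, and let $f:Q\to\mathbb{D}$ be a conformal $C^1$ diffeomorphism (bijective, $f$ and $f^{-1}$ of class $C^1$ up to the boundary, and for each $q\in Q$ the Jacobian $J_f(q)=\partial f/\partial q:T_qQ\to\mathbb{R}^2$ is a positive multiple of a linear isometry). Let $\phi:Q\to(0,\infty)$ be continuous and let $k_1,\dots,k_n>0$. For $P=(p_1,\dots,p_n)\in Q^n$ define the coverage cost $$H(P)=\int_Q\min_{1\le i\le n}\|f(q)-f(p_i)\|^2\,\phi(q)\,dq$$ ($dq$ is surface area), the Voronoi cells $$V_i=\{w\in\mathbb{D}:\ \|w-f(p_i)\|\le\|w-f(p_j)\|\ \text{for all } j\},$$ and their centers of mass $$C_{V_i}=\frac{\int_{V_i}w\,\tilde\phi(w)\,dw}{\int_{V_i}\tilde\phi(w)\,dw},\qquad \tilde\phi(w)=\phi(f^{-1}(w))\,|\det J_{f^{-1}}(w)|,$$ where $|\det A|=\sqrt{\det(A^{T}A)}$ for $A:\mathbb{R}^2\to\mathbb{R}^3$,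 so that $\tilde\phi$ is the density $\phi$ transported to $\mathbb{D}$ by $w=f(q)$. Call $P\in Q^n$ a centroidal Voronoi configuration if the $p_i$ are pairwise distinct and $f(p_i)=C_{V_i}$ for all $i$. Then the control law $$\dot p_i=u_i=-k_i\,J_f^{-1}(f(p_i))\,\bigl(f(p_i)-C_{V_i}\bigr),\qquad i=1,\dots,n,$$ where $J_f^{-1}(f(p_i)):\mathbb{R}^2\to T_{p_i}Q$ is the inverse of $J_f(p_i)$, solves the problem of minimizing $H$ over $Q^n$ in the following (suboptimal) sense. 1. Among the $P\in Q^n$ with pairwise distinct $p_i$, the centroidal Voronoi configurations are exactly the critical points of $H$ on $Q^n$ (the points at which $H$ is differentiable along $Q^n$ with derivative $0$). 2. For every $P_0\in Q^n$ with pairwise distinct components there is a unique trajectory $P:[0,\infty)\to Q^n$ of the control law with $P(0)=P_0$. Along it the agents remain pairwise distinct; $H(P(t))$ is nonincreasing, and $H(P(t))<H(P(s))$ for all $t>s\ge 0$ whenever $P(s)$ is not a centroidal Voronoi configuration; and as $t\to\infty$ one has $f(p_i(t))-C_{V_i}(t)\to0$ for every $i$, and $P(t)$ converges to the set of centroidal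 Voronoi configurations, i.e. it eventually enters and stays in every open set containing that set. -/

import Mathlib

open Set Filter Topology MeasureTheory

noncomputable section

namespace SurfaceCoverage

/-- The ambient space of the surface, with the Euclidean norm. -/
abbrev E3 : Type := EuclideanSpace ℝ (Fin 3)

/-- The plane that contains the disk, with the Euclidean norm. -/
abbrev E2 : Type := EuclideanSpace ℝ (Fin 2)

/-- The (closed) unit disk `𝔻`. -/
def disk : Set E2 := Metric.closedBall 0 1

/-- `Q` is an embedded `C¹` surface with (possibly empty) boundary in `ℝ³`: near each of its points
an ambient `C¹` diffeomorphism straightens `Q` to a piece of the half-plane `x₀ ≥ 0, x₂ = 0`. -/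
def IsEmbeddedSurface (Q : Set E3) : Prop :=
  ∀ q ∈ Q, ∃ Φ : OpenPartialHomeomorph E3 E3,
    q ∈ Φ.source ∧ ContDiffOn ℝ 1 Φ Φ.source ∧ ContDiffOn ℝ 1 Φ.symm Φ.target ∧
    ∀ x ∈ Φ.source, x ∈ Q ↔ 0 ≤ (Φ x) 0 ∧ (Φ x) 2 = 0

/-- The tangent plane `T_q Q`, as a linear subspace of `ℝ³`. At a boundary point the one-sided
tangent directions span the whole plane. -/
def tangentPlane (Q : Set E3) (q : E3) : Submodule ℝ E3 :=
  Submodule.span ℝ (tangentConeAt ℝ Q q)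

/-- The Jacobian `J_f(q) = ∂f/∂q : T_q Q → ℝ²` of a map `f` defined on the surface `Q`. -/
def jacobian (f : E3 → E2) (Q : Set E3) (q : E3) : tangentPlane Q q →L[ℝ] E2 :=
  (fderivWithin ℝ f Q q).comp (tangentPlane Q q).subtypeL

/-- The inverse map `f⁻¹ : 𝔻 → Q`. -/
def inverseMap (f : E3 → E2) (Q : Set E3) : E2 → E3 := Function.invFunOn f Q

/-- `f` is a conformal diffeomorphism of class `C¹` from the surface `Q` onto the unit disk: it is
bijective, `C¹` with `C¹` inverse (up to the boundary), and at each point its Jacobian is a positive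
multiple of a linear isometry of the tangent plane. -/
structure IsConformalDiffeo (f : E3 → E2) (Q : Set E3) : Prop where
  bijOn : BijOn f Q disk
  contDiffOn : ContDiffOn ℝ 1 f Q
  contDiffOn_inverse : ContDiffOn ℝ 1 (inverseMap f Q) disk
  conformal : ∀ q ∈ Q, IsConformalMap (jacobian f Q q)

variable {n : ℕ}

/-- The coverage cost `H(P) = ∫_Q min_i ‖f(q) - f(p_i)‖² φ(q) dq`, where `dq` is the surface area
(the two-dimensional Hausdorff measure, normalized to be Lebesgue measure on planes). -/
def cost (f : E3 → E2) (Q : Set E3) (φ : E3 → ℝ) (P : Fin n → E3) : ℝ :=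
  ∫ q in Q, (⨅ i, ‖f q - f (P i)‖ ^ 2) * φ q ∂(μHE[2] : Measure E3)

/-- The Voronoi cell `V_i` in the disk generated by the points `ς`. -/
def voronoiCell (ς : Fin n → E2) (i : Fin n) : Set E2 :=
  {w | w ∈ disk ∧ ∀ j, ‖w - ς i‖ ≤ ‖w - ς j‖}

/-- The density `φ` transported from the surface to the disk by the change of variables `w = f(q)`:
`w ↦ φ(f⁻¹(w)) |det J_{f⁻¹}(w)|`. For a linear map `A : ℝ² → ℝ³` the area factor `|det A|` is
`√det(AᵀA)`. -/
def diskDensity (f : E3 → E2) (Q : Set E3) (φ : E3 → ℝ) (w : E2) : ℝ :=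
  φ (inverseMap f Q w) *
    (fderivWithin ℝ (inverseMap f Q) disk w).toLinearMap.normDet

/-- The mass `M_V` of a region `V` of the disk. -/
def mass (f : E3 → E2) (Q : Set E3) (φ : E3 → ℝ) (V : Set E2) : ℝ :=
  ∫ w in V, diskDensity f Q φ w

/-- The center of mass `C_V` of a region `V` of the disk. -/
def centroid (f : E3 → E2) (Q : Set E3) (φ : E3 → ℝ) (V : Set E2) : E2 :=
  (mass f Q φ V)⁻¹ • ∫ w in V, diskDensity f Q φ w • w

/-- `C_{V_i}`: the center of mass of the Voronoi cell of `f(p_i)` in the disk. -/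
def cellCentroid (f : E3 → E2) (Q : Set E3) (φ : E3 → ℝ) (P : Fin n → E3) (i : Fin n) : E2 :=
  centroid f Q φ (voronoiCell (fun j => f (P j)) i)

/-- The control law `u_i = -k_i J_f⁻¹(f(p_i)) (f(p_i) - C_{V_i})`, a vector tangent to `Q` at `p_i`,
here regarded as a vector of `ℝ³`. -/
def control (f : E3 → E2) (Q : Set E3) (φ : E3 → ℝ) (k : Fin n → ℝ) (P : Fin n → E3)
    (i : Fin n) : E3 :=
  -(k i) • (((jacobian f Q (P i)).inverse (f (P i) - cellCentroid f Q φ P i) :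
    tangentPlane Q (P i)) : E3)

/-- `P` is a trajectory on `[0, ∞)` of the agents `dp_i/dt = u_i`, moving on the surface `Q`. -/
structure IsTrajectory (f : E3 → E2) (Q : Set E3) (φ : E3 → ℝ) (k : Fin n → ℝ)
    (P : ℝ → Fin n → E3) : Prop where
  mem : ∀ t, 0 ≤ t → ∀ i, P t i ∈ Q
  hasDeriv : ∀ t, 0 ≤ t → ∀ i,
    HasDerivWithinAt (fun s => P s i) (control f Q φ k (P t) i) (Ici 0) t

/-- The centroidal Voronoi configurations: distinct agent positions on `Q` such that the image of
every agent is the center of mass of its own Voronoi cell. -/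
def centroidalConfigs (f : E3 → E2) (Q : Set E3) (φ : E3 → ℝ) (n : ℕ) : Set (Fin n → E3) :=
  {P | (∀ i, P i ∈ Q) ∧ Function.Injective P ∧ ∀ i, f (P i) = cellCentroid f Q φ P i}

end SurfaceCoverage

end

noncomputable section

namespace SurfaceCoverage

open scoped RealInnerProductSpace NNReal ENNReal

/-! ### Voronoi cells in the disk and areas of slabs -/

section

/-! Everything is carried to the disk by `w = f(q)`. The area formula `map_restrict_eq_withDensity`
turns the cost into the planar cost of `z = f(P)` for the density `ρ = diskDensity f Q φ`, and since
the inverse of the Jacobian is the derivative of the inverse map (`jacobian_inverse_apply`), the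
control law becomes `z_i' = -k_i (z_i - C_i(z))`. What remains is a planar problem for a continuous
positive density.

Differentiability. Keeping the Voronoi partition of `z` while moving the points overestimates the
cost, with equality at `z`, by an explicit quadratic expression with gradient `2 M_i (z_i - C_i)`,
where `M_i` is the cell mass (`planarCost_sub_le`). The same bound with the roles exchanged, and the
Lipschitz dependence of this gradient on separated configurations, give the derivative
(`hasFDerivWithinAt_planarCost`). Masses are positive, so critical means centroidal, and along the
flow the cost decreases at rate `∑ 2 k_i M_i ‖z_i - C_i‖²`.

Well-posedness. The field is shown to be Lipschitz only where the points keep a fixed distance. Each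
center of mass lies in its own cell, hence on its own side of every bisector, so mutual distances
shrink at most exponentially (`exp_mul_norm_sub_le`) and no collision occurs in finite time.
Existence follows by solving a globally Lipschitz modification that agrees with the law on separated
configurations.

Convergence. Distances might still tend to zero as time grows, so the usual invariance argument
lacks a compact set on which the field is continuous. It is replaced by a quantitative bound: near a
configuration with coincident points, some cell of the cluster has substantial area but lies on one
side of a bisector passing very near its generator, so its center of mass is far from the generator
(`exists_le_decayRate_of_not_injective`). Hence the decay rate is bounded below off every
neighborhood of the centroidal set. Since the speed is bounded and the cost is nonnegative, late
excursions from a neighborhood are impossible (`tendsto_nhdsSet`). -/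

/-- In orthonormal coordinates with first axis along `v`, the set lies in a box with sides `(β - α)
/ ‖v‖` and `2`. -/
theorem volume_disk_inter_slab_le {v : E2} (hv : v ≠ 0) (α β : ℝ) :
    volume {w : E2 | w ∈ disk ∧ α ≤ ⟪v, w⟫ ∧ ⟪v, w⟫ ≤ β} ≤
      ENNReal.ofReal (2 * (β - α) / ‖v‖) := by
  have hv' : 0 < ‖v‖ := norm_pos_iff.2 hv
  set e : E2 := ‖v‖⁻¹ • v with he
  have hve : v = ‖v‖ • e := by rw [he, smul_smul, mul_inv_cancel₀ hv'.ne', one_smul]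
  have hen : ‖e‖ = 1 := by rw [he, norm_smul, norm_inv, norm_norm, inv_mul_cancel₀ hv'.ne']
  obtain ⟨b, hb⟩ := Orthonormal.exists_orthonormalBasis_extension_of_card_eq (𝕜 := ℝ) (E := E2)
    (ι := Fin 2) (by simp) (v := fun _ => e) (s := {0})
    ⟨fun i => hen, fun i j hij => (hij (Subsingleton.elim i j)).elim⟩
  have hb0 : b 0 = e := hb 0 rfl
  set B : Set (Fin 2 → ℝ) := Icc ![α / ‖v‖, -1] ![β / ‖v‖, 1] with hB
  have hBm : MeasurableSet B := measurableSet_Icc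
  have h1 : MeasurePreserving (fun w : E2 => (WithLp.ofLp (b.repr w) : Fin 2 → ℝ)) volume volume :=
    (PiLp.volume_preserving_ofLp (Fin 2)).comp b.measurePreserving_repr
  calc volume {w : E2 | w ∈ disk ∧ α ≤ ⟪v, w⟫ ∧ ⟪v, w⟫ ≤ β}
      ≤ volume ((fun w : E2 => (WithLp.ofLp (b.repr w) : Fin 2 → ℝ)) ⁻¹' B) := by
        refine measure_mono ?_
        rintro w ⟨hw, h2, h3⟩
        have hvw : ⟪v, w⟫ = ‖v‖ * ⟪e, w⟫ := by
          conv_lhs => rw [hve, real_inner_smul_left]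
        have hw1 : ‖w‖ ≤ 1 := by simpa [disk] using hw
        have h4 : |⟪b 1, w⟫| ≤ 1 := by
          calc |⟪b 1, w⟫| ≤ ‖b 1‖ * ‖w‖ := abs_real_inner_le_norm _ _
            _ ≤ 1 := by rw [b.norm_eq_one, one_mul]; exact hw1
        rw [hvw] at h2 h3
        rw [abs_le] at h4
        refine ⟨fun i => ?_, fun i => ?_⟩
        · fin_cases i
          · simpa [b.repr_apply_apply, hb0, div_le_iff₀ hv', mul_comm] using h2
          · simpa [b.repr_apply_apply] using h4.1
        · fin_cases i
          · simpa [b.repr_apply_apply, hb0, le_div_iff₀ hv', mul_comm] using h3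
          · simpa [b.repr_apply_apply] using h4.2
    _ = volume B := h1.measure_preimage hBm.nullMeasurableSet
    _ = ENNReal.ofReal (2 * (β - α) / ‖v‖) := by
        rw [hB, Real.volume_Icc_pi, Fin.prod_univ_two]
        simp only [Matrix.cons_val_zero, Matrix.cons_val_one]
        rw [mul_comm, ← ENNReal.ofReal_mul (by norm_num)]
        congr 1
        ring

theorem norm_sub_le_norm_sub_iff (w x y : E2) :
    ‖w - x‖ ≤ ‖w - y‖ ↔ ‖x‖ ^ 2 - ‖y‖ ^ 2 ≤ 2 * ⟪x - y, w⟫ := by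
  rw [← sq_le_sq₀ (norm_nonneg _) (norm_nonneg _), norm_sub_sq_real, norm_sub_sq_real,
    inner_sub_left, real_inner_comm x w, real_inner_comm y w]
  constructor <;> intro h <;> linarith

theorem convex_disk : Convex ℝ disk := convex_closedBall _ _

theorem isCompact_disk : IsCompact disk := isCompact_closedBall _ _

theorem measurableSet_disk : MeasurableSet disk := isCompact_disk.measurableSet

theorem norm_le_one_of_mem_disk {w : E2} (hw : w ∈ disk) : ‖w‖ ≤ 1 := by simpa [disk] using hw

theorem mem_disk_iff {w : E2} : w ∈ disk ↔ ‖w‖ ≤ 1 := by simp [disk]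

theorem norm_sub_le_two {w x : E2} (hw : w ∈ disk) (hx : x ∈ disk) : ‖w - x‖ ≤ 2 :=
  (norm_sub_le _ _).trans (by
    linarith [norm_le_one_of_mem_disk hw, norm_le_one_of_mem_disk hx])

variable {n : ℕ}

theorem voronoiCell_eq (z : Fin n → E2) (i : Fin n) :
    voronoiCell z i = disk ∩ ⋂ j, {w | ‖z i‖ ^ 2 - ‖z j‖ ^ 2 ≤ 2 * ⟪z i - z j, w⟫} := by
  ext w
  simp [voronoiCell, norm_sub_le_norm_sub_iff]

theorem voronoiCell_subset_disk (z : Fin n → E2) (i : Fin n) : voronoiCell z i ⊆ disk :=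
  fun _ hw => hw.1

theorem isClosed_voronoiCell (z : Fin n → E2) (i : Fin n) : IsClosed (voronoiCell z i) := by
  rw [voronoiCell_eq]
  exact isCompact_disk.isClosed.inter
    (isClosed_iInter fun j => isClosed_le continuous_const (by fun_prop))

theorem measurableSet_voronoiCell (z : Fin n → E2) (i : Fin n) :
    MeasurableSet (voronoiCell z i) := (isClosed_voronoiCell z i).measurableSet

/-- Shifting the center toward the origin by at most `r / 2` makes room for radius `r / 2` inside
the disk, even when `x` is on the boundary circle. -/
theorem closedBall_subset_disk_inter_closedBall {x : E2} (hx : x ∈ disk) {r : ℝ}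
    (hr0 : 0 ≤ r) (hr : r ≤ 1) :
    Metric.closedBall ((1 - r / 2) • x) (r / 2) ⊆ disk ∩ Metric.closedBall x r := by
  intro w hw
  rw [mem_closedBall_iff_norm] at hw
  have hx1 := norm_le_one_of_mem_disk hx
  refine ⟨mem_disk_iff.2 ?_, mem_closedBall_iff_norm.2 ?_⟩
  · have : w = (w - (1 - r / 2) • x) + (1 - r / 2) • x := by abel
    rw [this]
    refine (norm_add_le _ _).trans ?_
    rw [norm_smul, Real.norm_of_nonneg (by linarith)]
    nlinarith [norm_nonneg x]
  · have : w - x = (w - (1 - r / 2) • x) - (r / 2) • x := by module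
    rw [this]
    refine (norm_sub_le _ _).trans ?_
    rw [norm_smul, Real.norm_of_nonneg (by linarith)]
    nlinarith [norm_nonneg x]

theorem closedBall_subset_voronoiCell {z : Fin n → E2} {i : Fin n} (hz : z i ∈ disk) {r : ℝ}
    (hr0 : 0 ≤ r) (hr : r ≤ 1) (h : ∀ j, z j = z i ∨ 2 * r ≤ ‖z i - z j‖) :
    Metric.closedBall ((1 - r / 2) • z i) (r / 2) ⊆ voronoiCell z i := by
  intro w hw
  obtain ⟨h1, h2⟩ := closedBall_subset_disk_inter_closedBall hz hr0 hr hw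
  rw [mem_closedBall_iff_norm] at h2
  refine ⟨h1, fun j => ?_⟩
  rcases h j with hj | hj
  · rw [hj]
  · have : ‖z i - z j‖ ≤ ‖w - z i‖ + ‖w - z j‖ := by
      rw [norm_sub_rev w (z i)]
      exact norm_sub_le_norm_sub_add_norm_sub _ _ _
    linarith

theorem exists_radius (z : Fin n → E2) (i : Fin n) :
    ∃ r : ℝ, 0 < r ∧ r ≤ 1 ∧ ∀ j, z j = z i ∨ 2 * r ≤ ‖z i - z j‖ := by
  have h : ∀ᶠ r : ℝ in 𝓝[>] 0, r ≤ 1 ∧ ∀ j, z j = z i ∨ 2 * r ≤ ‖z i - z j‖ := by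
    have h0 : ∀ c : ℝ, 0 < c → ∀ᶠ r : ℝ in 𝓝[>] 0, r ≤ c := fun c hc =>
      (eventually_le_nhds hc).filter_mono nhdsWithin_le_nhds
    refine (h0 1 one_pos).and (eventually_all.2 fun j => ?_)
    by_cases hj : z j = z i
    · exact Eventually.of_forall fun r => Or.inl hj
    · have : 0 < ‖z i - z j‖ := norm_pos_iff.2 (sub_ne_zero.2 (Ne.symm hj))
      filter_upwards [h0 (‖z i - z j‖ / 2) (by linarith)] with r hr
      exact Or.inr (by linarith)
  obtain ⟨r, hr, hr0⟩ := (h.and self_mem_nhdsWithin).exists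
  exact ⟨r, hr0, hr.1, hr.2⟩

theorem iUnion_voronoiCell [NeZero n] (z : Fin n → E2) : ⋃ i, voronoiCell z i = disk := by
  refine Subset.antisymm (iUnion_subset fun i => voronoiCell_subset_disk z i) fun w hw => ?_
  obtain ⟨i, hi⟩ := Finite.exists_min fun j => ‖w - z j‖
  exact mem_iUnion.2 ⟨i, hw, hi⟩

/-- Common points lie on the bisector, a slab of width zero. -/
theorem volume_voronoiCell_inter {z : Fin n → E2} {i j : Fin n} (h : z i ≠ z j) :
    volume (voronoiCell z i ∩ voronoiCell z j) = 0 := by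
  have hv : z i - z j ≠ 0 := sub_ne_zero.2 h
  set c := (‖z i‖ ^ 2 - ‖z j‖ ^ 2) / 2
  refine measure_mono_null (t := {w | w ∈ disk ∧ c ≤ ⟪z i - z j, w⟫ ∧ ⟪z i - z j, w⟫ ≤ c}) ?_
    (le_antisymm ((volume_disk_inter_slab_le hv c c).trans (by simp)) bot_le)
  rintro w ⟨h1, h2⟩
  have h3 := (norm_sub_le_norm_sub_iff _ _ _).1 (h1.2 j)
  have h4 := (norm_sub_le_norm_sub_iff _ _ _).1 (h2.2 i)
  rw [← neg_sub (z i) (z j), inner_neg_left] at h4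
  refine ⟨h1.1, ?_, ?_⟩ <;> simp only [c] <;> linarith

end

/-! ### Mass and center of mass of a cell, and their Lipschitz dependence on the generators -/

section

/-- A continuous positive density on the disk. -/
structure IsDensity (ρ : E2 → ℝ) : Prop where
  continuousOn : ContinuousOn ρ disk
  pos : ∀ w ∈ disk, 0 < ρ w

/-- The mass of the `i`-th Voronoi cell for the density `ρ`. -/
def cellMass {n : ℕ} (ρ : E2 → ℝ) (z : Fin n → E2) (i : Fin n) : ℝ := ∫ w in voronoiCell z i, ρ w

/-- The first moment of the `i`-th Voronoi cell for the density `ρ`. -/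
def cellMoment {n : ℕ} (ρ : E2 → ℝ) (z : Fin n → E2) (i : Fin n) : E2 :=
  ∫ w in voronoiCell z i, ρ w • w

/-- The center of mass of the `i`-th Voronoi cell for the density `ρ`. -/
def cellCenter {n : ℕ} (ρ : E2 → ℝ) (z : Fin n → E2) (i : Fin n) : E2 :=
  (cellMass ρ z i)⁻¹ • cellMoment ρ z i

/-- The configurations in the disk whose points have mutual distances at least `δ`. -/
def separated (n : ℕ) (δ : ℝ) : Set (Fin n → E2) :=
  {z | (∀ i, z i ∈ disk) ∧ ∀ i j, i ≠ j → δ ≤ ‖z i - z j‖}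

variable {n : ℕ} {ρ : E2 → ℝ}

theorem IsDensity.exists_lower_bound (hρ : IsDensity ρ) : ∃ m, 0 < m ∧ ∀ w ∈ disk, m ≤ ρ w := by
  obtain ⟨x, hx, h⟩ := isCompact_disk.exists_isMinOn ⟨0, by simp [disk]⟩ hρ.continuousOn
  exact ⟨ρ x, hρ.pos x hx, fun w hw => h hw⟩

theorem integrableOn_of_subset_disk {F : Type*} [NormedAddCommGroup F] {G : E2 → F}
    (hG : ContinuousOn G disk) {A : Set E2} (hA : A ⊆ disk) : IntegrableOn G A :=
  (hG.integrableOn_compact isCompact_disk).mono_set hA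

theorem IsDensity.integrableOn (hρ : IsDensity ρ) {A : Set E2} (hA : A ⊆ disk) :
    IntegrableOn ρ A := integrableOn_of_subset_disk hρ.continuousOn hA

theorem IsDensity.integrableOn_moment (hρ : IsDensity ρ) {A : Set E2} (hA : A ⊆ disk) :
    IntegrableOn (fun w => ρ w • w) A :=
  integrableOn_of_subset_disk (hρ.continuousOn.smul continuousOn_id) hA

theorem volume_ne_top_of_subset_disk {A : Set E2} (hA : A ⊆ disk) : volume A ≠ ⊤ :=
  ((measure_mono hA).trans_lt isCompact_disk.measure_lt_top).ne

theorem norm_setIntegral_sub_setIntegral_le {F : Type*} [NormedAddCommGroup F] [NormedSpace ℝ F]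
    {G : E2 → F} (hG : ContinuousOn G disk) {B : ℝ} (hB : ∀ w ∈ disk, ‖G w‖ ≤ B) {A A' : Set E2}
    (hA : A ⊆ disk) (hA' : A' ⊆ disk) (hAm : MeasurableSet A) (hAm' : MeasurableSet A') :
    ‖(∫ w in A, G w) - ∫ w in A', G w‖ ≤
      B * (volume.real (A \ A') + volume.real (A' \ A)) := by
  rw [← integral_inter_add_sdiff hAm' (integrableOn_of_subset_disk hG hA),
    ← integral_inter_add_sdiff hAm (integrableOn_of_subset_disk hG hA'), inter_comm A' A,
    add_sub_add_left_eq_sub, mul_add]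
  refine (norm_sub_le _ _).trans (add_le_add ?_ ?_)
  · exact norm_setIntegral_le_of_norm_le_const
      (volume_ne_top_of_subset_disk (sdiff_subset.trans hA)).lt_top fun w hw => hB w (hA hw.1)
  · exact norm_setIntegral_le_of_norm_le_const
      (volume_ne_top_of_subset_disk (sdiff_subset.trans hA')).lt_top fun w hw => hB w (hA' hw.1)

theorem abs_norm_sq_sub_norm_sq_le {w x y : E2} (hw : w ∈ disk) (hx : x ∈ disk) (hy : y ∈ disk) :
    |‖w - x‖ ^ 2 - ‖w - y‖ ^ 2| ≤ 4 * ‖x - y‖ := by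
  have h1 := norm_sub_le_two hw hx
  have h2 := norm_sub_le_two hw hy
  have h3 : |‖w - x‖ - ‖w - y‖| ≤ ‖x - y‖ := by
    have := abs_norm_sub_norm_le (w - x) (w - y)
    rwa [sub_sub_sub_cancel_left, norm_sub_rev y x] at this
  have h4 : ‖w - x‖ ^ 2 - ‖w - y‖ ^ 2 = (‖w - x‖ + ‖w - y‖) * (‖w - x‖ - ‖w - y‖) := by ring
  rw [h4, abs_mul, abs_of_nonneg (by positivity)]
  have h5 := abs_nonneg (‖w - x‖ - ‖w - y‖)
  nlinarith [norm_nonneg (w - x), norm_nonneg (w - y)]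

/-- A point that leaves the cell changes sides of some bisector. Moving the generators by at most
`ε` changes the difference of two squared distances by at most `8 * ε`, so such points lie in a slab
next to the old bisector whose width is of order `ε / δ`. -/
theorem volume_voronoiCell_diff_le {δ : ℝ} (hδ : 0 < δ) {z z' : Fin n → E2}
    (hz : z ∈ separated n δ) (hz' : z' ∈ separated n δ) (i : Fin n) :
    volume.real (voronoiCell z i \ voronoiCell z' i) ≤ n * (8 / δ) * ‖z - z'‖ := by
  set ε := ‖z - z'‖ with hε
  have hε0 : 0 ≤ ε := norm_nonneg _
  have hε' : ∀ j, ‖z j - z' j‖ ≤ ε := fun j => norm_le_pi_norm (z - z') j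
  let S : Fin n → Set E2 := fun j => {w | w ∈ voronoiCell z i ∧ ‖w - z' j‖ < ‖w - z' i‖}
  have hsub : voronoiCell z i \ voronoiCell z' i ⊆ ⋃ j, S j := by
    rintro w ⟨h1, h2⟩
    by_contra h
    simp only [mem_iUnion, not_exists] at h
    exact h2 ⟨h1.1, fun j => not_lt.1 fun hj => h j ⟨h1, hj⟩⟩
  have hS : ∀ j, volume (S j) ≤ ENNReal.ofReal (8 / δ * ε) := by
    intro j
    by_cases hij : i = j
    · have : S j = ∅ := by
        subst hij
        exact eq_empty_of_forall_notMem fun w hw => lt_irrefl _ hw.2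
      simp [this]
    have hd := hz.2 i j hij
    have hv : z i - z j ≠ 0 := norm_pos_iff.1 (hδ.trans_le hd)
    set c := (‖z i‖ ^ 2 - ‖z j‖ ^ 2) / 2 with hc
    calc volume (S j)
        ≤ volume {w | w ∈ disk ∧ c ≤ ⟪z i - z j, w⟫ ∧ ⟪z i - z j, w⟫ ≤ c + 4 * ε} := by
          refine measure_mono ?_
          rintro w ⟨h1, h2⟩
          have h3 := (norm_sub_le_norm_sub_iff _ _ _).1 (h1.2 j)
          refine ⟨h1.1, by linarith, ?_⟩
          have h4 := abs_le.1 (abs_norm_sq_sub_norm_sq_le h1.1 (hz.1 i) (hz'.1 i))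
          have h5 := abs_le.1 (abs_norm_sq_sub_norm_sq_le h1.1 (hz.1 j) (hz'.1 j))
          have h6 : ‖w - z' j‖ ^ 2 ≤ ‖w - z' i‖ ^ 2 := by gcongr
          have h7 : ‖w - z j‖ ^ 2 - ‖w - z i‖ ^ 2 = 2 * ⟪z i - z j, w⟫ - 2 * c := by
            rw [norm_sub_sq_real, norm_sub_sq_real, inner_sub_left, real_inner_comm w (z i),
              real_inner_comm w (z j), hc]
            ring
          linarith [hε' i, hε' j]
      _ ≤ ENNReal.ofReal (2 * (c + 4 * ε - c) / ‖z i - z j‖) := volume_disk_inter_slab_le hv _ _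
      _ ≤ ENNReal.ofReal (8 / δ * ε) := by
          apply ENNReal.ofReal_le_ofReal
          rw [div_mul_eq_mul_div]
          exact div_le_div₀ (by positivity) (by linarith) hδ hd
  refine ENNReal.toReal_le_of_le_ofReal (by positivity) ?_
  calc volume (voronoiCell z i \ voronoiCell z' i) ≤ ∑ j, volume (S j) :=
        (measure_mono hsub).trans (measure_iUnion_fintype_le _ _)
    _ ≤ ∑ _j : Fin n, ENNReal.ofReal (8 / δ * ε) := Finset.sum_le_sum fun j _ => hS j
    _ = ENNReal.ofReal (n * (8 / δ) * ε) := by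
        rw [Finset.sum_const, Finset.card_univ, Fintype.card_fin, mul_assoc,
          ENNReal.ofReal_mul (Nat.cast_nonneg n), ENNReal.ofReal_natCast, nsmul_eq_mul]

theorem exists_lipschitz_setIntegral_voronoiCell {F : Type*} [NormedAddCommGroup F]
    [NormedSpace ℝ F] {G : E2 → F} (hG : ContinuousOn G disk) {δ : ℝ} (hδ : 0 < δ) :
    ∃ L, 0 ≤ L ∧ ∀ z ∈ separated n δ, ∀ z' ∈ separated n δ, ∀ i,
      ‖(∫ w in voronoiCell z i, G w) - ∫ w in voronoiCell z' i, G w‖ ≤ L * ‖z - z'‖ := by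
  obtain ⟨B, hB⟩ := isCompact_disk.exists_bound_of_continuousOn hG
  have hB0 : 0 ≤ B := (norm_nonneg _).trans (hB 0 (by simp [disk]))
  refine ⟨B * (2 * (n * (8 / δ))), by positivity, fun z hz z' hz' i => ?_⟩
  refine (norm_setIntegral_sub_setIntegral_le hG hB (voronoiCell_subset_disk z i)
    (voronoiCell_subset_disk z' i) (measurableSet_voronoiCell z i)
    (measurableSet_voronoiCell z' i)).trans ?_
  rw [mul_assoc B]
  gcongr
  have h1 := volume_voronoiCell_diff_le hδ hz hz' i
  have h2 := volume_voronoiCell_diff_le hδ hz' hz i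
  rw [norm_sub_rev] at h2
  linarith

theorem mul_volume_le_setIntegral (hρ : IsDensity ρ) {m : ℝ} (hm : ∀ w ∈ disk, m ≤ ρ w)
    {A V : Set E2} (hAV : A ⊆ V) (hV : V ⊆ disk) (hA : MeasurableSet A) (hVm : MeasurableSet V) :
    m * volume.real A ≤ ∫ w in V, ρ w := by
  calc m * volume.real A = ∫ _w in A, m := by simp [mul_comm]
    _ ≤ ∫ w in A, ρ w := setIntegral_mono_on
        (integrableOn_const (volume_ne_top_of_subset_disk (hAV.trans hV)))
        (hρ.integrableOn (hAV.trans hV)) hA fun w hw => hm w (hV (hAV hw))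
    _ ≤ ∫ w in V, ρ w := setIntegral_mono_set (hρ.integrableOn hV)
        ((ae_restrict_iff' hVm).2 (Eventually.of_forall fun w hw => (hρ.pos w (hV hw)).le))
        (LE.le.eventuallyLE hAV)

theorem mul_volume_closedBall_le_cellMass (hρ : IsDensity ρ) {m : ℝ} (hm : ∀ w ∈ disk, m ≤ ρ w)
    {z : Fin n → E2} {i : Fin n} (hz : z i ∈ disk) {r : ℝ}
    (hr0 : 0 ≤ r) (hr : r ≤ 1) (h : ∀ j, z j = z i ∨ 2 * r ≤ ‖z i - z j‖) :
    m * volume.real (Metric.closedBall (0 : E2) (r / 2)) ≤ cellMass ρ z i := by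
  rw [← Measure.addHaar_real_closedBall_center volume ((1 - r / 2) • z i)]
  exact mul_volume_le_setIntegral hρ hm (closedBall_subset_voronoiCell hz hr0 hr h)
    (voronoiCell_subset_disk z i) Metric.isClosed_closedBall.measurableSet
    (measurableSet_voronoiCell z i)

theorem volume_real_closedBall_pos {r : ℝ} (hr : 0 < r) :
    0 < volume.real (Metric.closedBall (0 : E2) r) :=
  ENNReal.toReal_pos (Metric.measure_closedBall_pos volume _ hr).ne'
    (isCompact_closedBall _ _).measure_lt_top.ne

theorem cellMass_pos (hρ : IsDensity ρ) {z : Fin n → E2} {i : Fin n} (hz : z i ∈ disk) :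
    0 < cellMass ρ z i := by
  obtain ⟨m, hm0, hm⟩ := hρ.exists_lower_bound
  obtain ⟨r, hr0, hr1, hr⟩ := exists_radius z i
  exact (mul_pos hm0 (volume_real_closedBall_pos (half_pos hr0))).trans_le
    (mul_volume_closedBall_le_cellMass hρ hm hz hr0.le hr1 hr)

/-- Separation leaves a ball of fixed radius inside every cell, and the density is bounded below. -/
theorem exists_le_cellMass (hρ : IsDensity ρ) {δ : ℝ} (hδ : 0 < δ) :
    ∃ μ, 0 < μ ∧ ∀ z ∈ separated n δ, ∀ i, μ ≤ cellMass ρ z i := by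
  obtain ⟨m, hm0, hm⟩ := hρ.exists_lower_bound
  have hr : 0 < min 1 (δ / 2) := by positivity
  refine ⟨_, mul_pos hm0 (volume_real_closedBall_pos (half_pos hr)), fun z hz i =>
    mul_volume_closedBall_le_cellMass hρ hm (hz.1 i) hr.le (min_le_left _ _) fun j => ?_⟩
  by_cases hij : i = j
  · exact Or.inl (by rw [hij])
  · exact Or.inr (by linarith [hz.2 i j hij, min_le_right 1 (δ / 2)])

theorem cellMass_le (hρ : IsDensity ρ) (z : Fin n → E2) (i : Fin n) :
    cellMass ρ z i ≤ ∫ w in disk, ρ w :=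
  setIntegral_mono_set (hρ.integrableOn Subset.rfl)
    ((ae_restrict_iff' measurableSet_disk).2 (Eventually.of_forall fun w hw => (hρ.pos w hw).le))
    (LE.le.eventuallyLE (voronoiCell_subset_disk z i))

theorem cellMass_smul_cellCenter (hρ : IsDensity ρ) {z : Fin n → E2} {i : Fin n}
    (hz : z i ∈ disk) : cellMass ρ z i • cellCenter ρ z i = cellMoment ρ z i := by
  rw [cellCenter, smul_smul, mul_inv_cancel₀ (cellMass_pos hρ hz).ne', one_smul]

theorem inner_cellMoment (hρ : IsDensity ρ) (z : Fin n → E2) (i : Fin n) (v : E2) :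
    ⟪v, cellMoment ρ z i⟫ = ∫ w in voronoiCell z i, ρ w * ⟪v, w⟫ := by
  rw [cellMoment, ← integral_inner (hρ.integrableOn_moment (voronoiCell_subset_disk z i))]
  simp only [real_inner_smul_right]

/-- Averaging an affine function over the cell evaluates it at the center of mass. This is how
bisector inequalities pass from the points of a cell to its center. -/
theorem cellMass_mul_inner_cellCenter_sub (hρ : IsDensity ρ) {z : Fin n → E2} {i : Fin n}
    (hz : z i ∈ disk) (v : E2) (c : ℝ) :
    cellMass ρ z i * (⟪v, cellCenter ρ z i⟫ - c) =
      ∫ w in voronoiCell z i, ρ w * (⟪v, w⟫ - c) := by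
  have h1 : IntegrableOn (fun w => ρ w * ⟪v, w⟫) (voronoiCell z i) :=
    integrableOn_of_subset_disk (hρ.continuousOn.mul (by fun_prop)) (voronoiCell_subset_disk z i)
  have h2 : IntegrableOn (fun w => ρ w * c) (voronoiCell z i) :=
    integrableOn_of_subset_disk (hρ.continuousOn.mul (by fun_prop)) (voronoiCell_subset_disk z i)
  simp only [mul_sub]
  rw [integral_sub h1 h2, ← inner_cellMoment hρ, integral_mul_const,
    ← cellMass_smul_cellCenter hρ hz, real_inner_smul_right]
  rfl

/-- The cell is cut out of the disk by half-planes, and each of these inequalities survives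
averaging. Collision avoidance rests on this. -/
theorem cellCenter_mem_voronoiCell (hρ : IsDensity ρ) {z : Fin n → E2} {i : Fin n}
    (hz : z i ∈ disk) : cellCenter ρ z i ∈ voronoiCell z i := by
  have hM := cellMass_pos hρ hz
  refine ⟨mem_disk_iff.2 ?_, fun j => (norm_sub_le_norm_sub_iff _ _ _).2 ?_⟩
  · rw [cellCenter, norm_smul, norm_inv, Real.norm_of_nonneg hM.le, inv_mul_le_iff₀ hM, mul_one]
    refine norm_integral_le_of_norm_le (hρ.integrableOn (voronoiCell_subset_disk z i)) ?_
    refine (ae_restrict_iff' (measurableSet_voronoiCell z i)).2 (Eventually.of_forall fun w hw => ?_)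
    rw [norm_smul, Real.norm_of_nonneg (hρ.pos w hw.1).le]
    exact mul_le_of_le_one_right (hρ.pos w hw.1).le (norm_le_one_of_mem_disk hw.1)
  · have h := cellMass_mul_inner_cellCenter_sub hρ hz (z i - z j) ((‖z i‖ ^ 2 - ‖z j‖ ^ 2) / 2)
    have h2 : 0 ≤ ∫ w in voronoiCell z i,
        ρ w * (⟪z i - z j, w⟫ - (‖z i‖ ^ 2 - ‖z j‖ ^ 2) / 2) :=
      setIntegral_nonneg (measurableSet_voronoiCell z i) fun w hw =>
        mul_nonneg (hρ.pos w hw.1).le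
          (by linarith [(norm_sub_le_norm_sub_iff _ _ _).1 (hw.2 j)])
    rw [← h] at h2
    linarith [nonneg_of_mul_nonneg_right h2 hM]

theorem cellCenter_mem_disk (hρ : IsDensity ρ) {z : Fin n → E2} {i : Fin n}
    (hz : z i ∈ disk) : cellCenter ρ z i ∈ disk := (cellCenter_mem_voronoiCell hρ hz).1

theorem exists_lipschitz_cellCenter (hρ : IsDensity ρ) {δ : ℝ} (hδ : 0 < δ) :
    ∃ L, 0 ≤ L ∧ ∀ z ∈ separated n δ, ∀ z' ∈ separated n δ, ∀ i,
      ‖cellCenter ρ z i - cellCenter ρ z' i‖ ≤ L * ‖z - z'‖ := by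
  obtain ⟨L₁, hL₁, h1⟩ := exists_lipschitz_setIntegral_voronoiCell (n := n) hρ.continuousOn hδ
  obtain ⟨L₂, hL₂, h2⟩ := exists_lipschitz_setIntegral_voronoiCell (n := n)
    (hρ.continuousOn.smul continuousOn_id) hδ
  obtain ⟨μ, hμ, h3⟩ := exists_le_cellMass (n := n) hρ hδ
  refine ⟨(L₁ + L₂) / μ, by positivity, fun z hz z' hz' i => ?_⟩
  set M := cellMass ρ z i with hM
  set M' := cellMass ρ z' i with hM'
  have hMpos : 0 < M := cellMass_pos hρ (hz.1 i)
  -- Quotient rule without division: the moments and masses are Lipschitz, the center is bounded by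
  -- `1`, and only the lower mass bound is needed at the end.
  have e : M • (cellCenter ρ z i - cellCenter ρ z' i) =
      (cellMoment ρ z i - cellMoment ρ z' i) - (M - M') • cellCenter ρ z' i := by
    rw [← cellMass_smul_cellCenter hρ (hz.1 i), ← cellMass_smul_cellCenter hρ (hz'.1 i), ← hM,
      ← hM']
    module
  have hn : M * ‖cellCenter ρ z i - cellCenter ρ z' i‖ ≤ (L₁ + L₂) * ‖z - z'‖ := by
    rw [← Real.norm_of_nonneg hMpos.le, ← norm_smul, e]
    refine (norm_sub_le _ _).trans ?_
    rw [norm_smul]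
    have h4 : ‖cellMoment ρ z i - cellMoment ρ z' i‖ ≤ L₂ * ‖z - z'‖ := h2 z hz z' hz' i
    have h5 : ‖M - M'‖ ≤ L₁ * ‖z - z'‖ := h1 z hz z' hz' i
    have h6 := norm_le_one_of_mem_disk (cellCenter_mem_disk hρ (hz'.1 i))
    nlinarith [norm_nonneg (M - M')]
  rw [div_mul_eq_mul_div, le_div_iff₀ hμ]
  calc _ = μ * ‖cellCenter ρ z i - cellCenter ρ z' i‖ := mul_comm _ _
    _ ≤ M * ‖cellCenter ρ z i - cellCenter ρ z' i‖ := by gcongr; exact h3 z hz i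
    _ ≤ _ := hn

end

/-! ### The planar cost and its derivative -/

section

variable {n : ℕ} {ρ : E2 → ℝ}

/-- The configurations of `n` points in the disk. -/
abbrev diskConfigs (n : ℕ) : Set (Fin n → E2) := Set.univ.pi fun _ => disk

/-- The coverage cost of the points `z` in the disk for the density `ρ`. -/
def planarCost (ρ : E2 → ℝ) (z : Fin n → E2) : ℝ := ∫ w in disk, (⨅ i, ‖w - z i‖ ^ 2) * ρ w

/-- Half the gradient of the coverage cost with respect to the `i`-th point. -/
def cellGrad (ρ : E2 → ℝ) (z : Fin n → E2) (i : Fin n) : E2 :=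
  cellMass ρ z i • (z i - cellCenter ρ z i)

/-- The derivative of the coverage cost. -/
def costDeriv (ρ : E2 → ℝ) (z : Fin n → E2) : (Fin n → E2) →L[ℝ] ℝ :=
  ∑ i, (2 : ℝ) • (innerSL ℝ (cellGrad ρ z i)).comp (ContinuousLinearMap.proj i)

theorem costDeriv_apply (z h : Fin n → E2) :
    costDeriv ρ z h = ∑ i, 2 * ⟪cellGrad ρ z i, h i⟫ := by
  simp [costDeriv]

theorem mem_diskConfigs {z : Fin n → E2} : z ∈ diskConfigs n ↔ ∀ i, z i ∈ disk := by simp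

theorem separated_subset_diskConfigs (δ : ℝ) : separated n δ ⊆ diskConfigs n :=
  fun _ hz => mem_diskConfigs.2 hz.1

/-- Localizes at a configuration of distinct points, so that the Lipschitz bounds on separated sets
yield continuity and differentiability there. -/
theorem exists_separated_mem_nhdsWithin {z : Fin n → E2} (hz : z ∈ diskConfigs n)
    (hi : Function.Injective z) :
    ∃ δ, 0 < δ ∧ z ∈ separated n δ ∧ separated n δ ∈ 𝓝[diskConfigs n] z := by
  have h : ∀ᶠ δ : ℝ in 𝓝[>] 0, ∀ i j, i ≠ j → δ < ‖z i - z j‖ := by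
    refine eventually_all.2 fun i => eventually_all.2 fun j => ?_
    by_cases hij : i = j
    · exact Eventually.of_forall fun _ h => (h hij).elim
    · have : 0 < ‖z i - z j‖ := norm_pos_iff.2 (sub_ne_zero.2 (hi.ne hij))
      filter_upwards [(eventually_lt_nhds this).filter_mono nhdsWithin_le_nhds] with δ hδ _
      exact hδ
  obtain ⟨δ, hδ, hδ0⟩ := (h.and self_mem_nhdsWithin).exists
  refine ⟨δ, hδ0, ⟨mem_diskConfigs.1 hz, fun i j hij => (hδ i j hij).le⟩, ?_⟩
  have h2 : ∀ᶠ y in 𝓝 z, ∀ i j, i ≠ j → δ < ‖y i - y j‖ := by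
    refine eventually_all.2 fun i => eventually_all.2 fun j => ?_
    by_cases hij : i = j
    · exact Eventually.of_forall fun _ h => (h hij).elim
    · have hc : Continuous fun y : Fin n → E2 => ‖y i - y j‖ := by fun_prop
      filter_upwards [hc.continuousAt.eventually (lt_mem_nhds (hδ i j hij))] with y hy _
      exact hy
  filter_upwards [h2.filter_mono nhdsWithin_le_nhds, self_mem_nhdsWithin] with y hy hyd
  exact ⟨mem_diskConfigs.1 hyd, fun i j hij => (hy i j hij).le⟩

theorem injective_of_mem_separated {δ : ℝ} (hδ : 0 < δ) {z : Fin n → E2}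
    (hz : z ∈ separated n δ) : Function.Injective z := by
  intro i j hij
  by_contra h
  have := hz.2 i j h
  rw [hij, sub_self, norm_zero] at this
  linarith

theorem continuousWithinAt_of_lipschitz_on_separated {F : Type*} [NormedAddCommGroup F]
    {u : (Fin n → E2) → F}
    (hu : ∀ δ : ℝ, 0 < δ → ∃ L, 0 ≤ L ∧ ∀ z ∈ separated n δ, ∀ z' ∈ separated n δ,
      ‖u z - u z'‖ ≤ L * ‖z - z'‖)
    {z : Fin n → E2} (hz : z ∈ diskConfigs n) (hi : Function.Injective z) :
    ContinuousWithinAt u (diskConfigs n) z := by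
  obtain ⟨δ, hδ, hzδ, hn⟩ := exists_separated_mem_nhdsWithin hz hi
  obtain ⟨L, hL, h⟩ := hu δ hδ
  have h1 : LipschitzOnWith ⟨L, hL⟩ u (separated n δ) :=
    LipschitzOnWith.of_dist_le_mul fun x hx y hy => by
      rw [dist_eq_norm, dist_eq_norm]
      exact h x hx y hy
  exact (h1.continuousOn z hzδ).mono_of_mem_nhdsWithin hn

theorem continuousWithinAt_cellMass (hρ : IsDensity ρ) {z : Fin n → E2} (hz : z ∈ diskConfigs n)
    (hi : Function.Injective z) (i : Fin n) :
    ContinuousWithinAt (fun y => cellMass ρ y i) (diskConfigs n) z := by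
  refine continuousWithinAt_of_lipschitz_on_separated (fun δ hδ => ?_) hz hi
  obtain ⟨L, hL, h⟩ := exists_lipschitz_setIntegral_voronoiCell (n := n) hρ.continuousOn hδ
  exact ⟨L, hL, fun z hz z' hz' => h z hz z' hz' i⟩

theorem continuousWithinAt_cellCenter (hρ : IsDensity ρ) {z : Fin n → E2} (hz : z ∈ diskConfigs n)
    (hi : Function.Injective z) (i : Fin n) :
    ContinuousWithinAt (fun y => cellCenter ρ y i) (diskConfigs n) z := by
  refine continuousWithinAt_of_lipschitz_on_separated (fun δ hδ => ?_) hz hi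
  obtain ⟨L, hL, h⟩ := exists_lipschitz_cellCenter (n := n) hρ hδ
  exact ⟨L, hL, fun z hz z' hz' => h z hz z' hz' i⟩

theorem exists_lipschitz_cellGrad (hρ : IsDensity ρ) {δ : ℝ} (hδ : 0 < δ) :
    ∃ L, 0 ≤ L ∧ ∀ z ∈ separated n δ, ∀ z' ∈ separated n δ, ∀ i,
      ‖cellGrad ρ z i - cellGrad ρ z' i‖ ≤ L * ‖z - z'‖ := by
  obtain ⟨L₁, hL₁, h1⟩ := exists_lipschitz_setIntegral_voronoiCell (n := n) hρ.continuousOn hδ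
  obtain ⟨L₂, hL₂, h2⟩ := exists_lipschitz_cellCenter (n := n) hρ hδ
  set T := ∫ w in disk, ρ w with hT
  have hT0 : 0 ≤ T := setIntegral_nonneg measurableSet_disk fun w hw => (hρ.pos w hw).le
  refine ⟨L₁ * 2 + T * (1 + L₂), by positivity, fun z hz z' hz' i => ?_⟩
  have e : cellGrad ρ z i - cellGrad ρ z' i =
      (cellMass ρ z i - cellMass ρ z' i) • (z i - cellCenter ρ z i) +
      cellMass ρ z' i • ((z i - z' i) - (cellCenter ρ z i - cellCenter ρ z' i)) := by
    simp only [cellGrad]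
    module
  rw [e]
  refine (norm_add_le _ _).trans ?_
  rw [norm_smul, norm_smul, Real.norm_of_nonneg (cellMass_pos hρ (hz'.1 i)).le]
  have h3 : ‖cellMass ρ z i - cellMass ρ z' i‖ ≤ L₁ * ‖z - z'‖ := h1 z hz z' hz' i
  have h4 : ‖(z i - z' i) - (cellCenter ρ z i - cellCenter ρ z' i)‖ ≤ (1 + L₂) * ‖z - z'‖ := by
    refine (norm_sub_le _ _).trans ?_
    have h7 : ‖z i - z' i‖ ≤ ‖z - z'‖ := norm_le_pi_norm (z - z') i
    linarith [h2 z hz z' hz' i]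
  have h5 := norm_sub_le_two (hz.1 i) (cellCenter_mem_disk hρ (hz.1 i))
  have h6 := cellMass_le hρ z' i
  calc _ ≤ (L₁ * ‖z - z'‖) * 2 + T * ((1 + L₂) * ‖z - z'‖) :=
        add_le_add (mul_le_mul h3 h5 (norm_nonneg _) (by positivity))
          (mul_le_mul h6 h4 (norm_nonneg _) hT0)
    _ = _ := by ring

theorem continuous_iInf_norm_sub_sq (z : Fin n → E2) :
    Continuous fun w => ⨅ i, ‖w - z i‖ ^ 2 := by
  rcases isEmpty_or_nonempty (Fin n) with h | h
  · simp only [Real.iInf_of_isEmpty]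
    exact continuous_const
  · simp only [← Finset.inf'_univ_eq_ciInf]
    exact Continuous.finset_inf'_apply _ fun i _ => by fun_prop

theorem iInf_norm_sub_sq_le (z : Fin n → E2) (w : E2) (i : Fin n) :
    ⨅ j, ‖w - z j‖ ^ 2 ≤ ‖w - z i‖ ^ 2 :=
  ciInf_le (Finite.bddBelow_range fun j => ‖w - z j‖ ^ 2) i

theorem iInf_norm_sub_sq_eq {z : Fin n → E2} {w : E2} {i : Fin n} (hw : w ∈ voronoiCell z i) :
    ⨅ j, ‖w - z j‖ ^ 2 = ‖w - z i‖ ^ 2 := by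
  have : Nonempty (Fin n) := ⟨i⟩
  refine le_antisymm (iInf_norm_sub_sq_le z w i) (le_ciInf fun j => ?_)
  gcongr
  exact hw.2 j

theorem setIntegral_disk_eq_sum_voronoiCell [NeZero n] {z : Fin n → E2}
    (hi : Function.Injective z) {G : E2 → ℝ} (hG : ContinuousOn G disk) :
    ∫ w in disk, G w = ∑ i, ∫ w in voronoiCell z i, G w := by
  rw [← iUnion_voronoiCell z, integral_iUnion_ae
    (fun i => (measurableSet_voronoiCell z i).nullMeasurableSet)
    (fun i j hij => volume_voronoiCell_inter (hi.ne hij))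
    (by rw [iUnion_voronoiCell]; exact integrableOn_of_subset_disk hG Subset.rfl), tsum_fintype]

/-- The terms quadratic in `w` cancel, so the integrand is `ρ` times an affine function and only
mass and center enter. -/
theorem setIntegral_norm_sub_sq_sub (hρ : IsDensity ρ) {z : Fin n → E2} {i : Fin n}
    (hz : z i ∈ disk) (x : E2) :
    ∫ w in voronoiCell z i, (‖w - x‖ ^ 2 - ‖w - z i‖ ^ 2) * ρ w =
      2 * ⟪cellGrad ρ z i, x - z i⟫ + cellMass ρ z i * ‖x - z i‖ ^ 2 := by
  have e : ∀ w, (‖w - x‖ ^ 2 - ‖w - z i‖ ^ 2) * ρ w =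
      (-2) * (ρ w * (⟪x - z i, w⟫ - (‖x‖ ^ 2 - ‖z i‖ ^ 2) / 2)) := by
    intro w
    rw [norm_sub_sq_real, norm_sub_sq_real, inner_sub_left, real_inner_comm w, real_inner_comm w]
    ring
  simp only [e]
  rw [integral_const_mul, ← cellMass_mul_inner_cellCenter_sub hρ hz, cellGrad,
    real_inner_smul_left, norm_sub_sq_real, inner_sub_right, inner_sub_left, inner_sub_left,
    inner_sub_left, real_inner_comm x (z i), real_inner_comm x (cellCenter ρ z i),
    real_inner_comm (z i) (cellCenter ρ z i), real_inner_self_eq_norm_sq]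
  ring

/-- On the `i`-th cell of `z` the minimum for `y` is at most the squared distance to `y i`, while
for `z` it is exactly the squared distance to `z i`. -/
theorem planarCost_sub_le (hρ : IsDensity ρ) [NeZero n] {z : Fin n → E2} (hz : z ∈ diskConfigs n)
    (hi : Function.Injective z) (y : Fin n → E2) :
    planarCost ρ y - planarCost ρ z ≤
      ∑ i, (2 * ⟪cellGrad ρ z i, y i - z i⟫ + cellMass ρ z i * ‖y i - z i‖ ^ 2) := by
  have hc : ∀ x : Fin n → E2, ContinuousOn (fun w => (⨅ i, ‖w - x i‖ ^ 2) * ρ w) disk := fun x =>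
    (continuous_iInf_norm_sub_sq x).continuousOn.mul hρ.continuousOn
  simp only [planarCost]
  rw [setIntegral_disk_eq_sum_voronoiCell hi (hc y), setIntegral_disk_eq_sum_voronoiCell hi (hc z),
    ← Finset.sum_sub_distrib]
  refine Finset.sum_le_sum fun i _ => ?_
  have hV := voronoiCell_subset_disk z i
  rw [← integral_sub (integrableOn_of_subset_disk (hc y) hV)
    (integrableOn_of_subset_disk (hc z) hV),
    ← setIntegral_norm_sub_sq_sub hρ (mem_diskConfigs.1 hz i)]
  refine setIntegral_mono_on ((integrableOn_of_subset_disk (hc y) hV).sub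
    (integrableOn_of_subset_disk (hc z) hV)) (integrableOn_of_subset_disk
      ((Continuous.continuousOn (by fun_prop)).mul hρ.continuousOn) hV)
    (measurableSet_voronoiCell z i) fun w hw => ?_
  rw [iInf_norm_sub_sq_eq hw, ← sub_mul]
  exact mul_le_mul_of_nonneg_right (sub_le_sub_right (iInf_norm_sub_sq_le y w i) _)
    (hρ.pos w hw.1).le

theorem hasFDerivWithinAt_planarCost (hρ : IsDensity ρ) {z : Fin n → E2} (hz : z ∈ diskConfigs n)
    (hi : Function.Injective z) :
    HasFDerivWithinAt (planarCost ρ) (costDeriv ρ z) (diskConfigs n) z := by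
  rcases Nat.eq_zero_or_pos n with rfl | hn
  · exact (hasFDerivAt_of_subsingleton _ _).hasFDerivWithinAt.congr_fderiv (Subsingleton.elim _ _)
  have : NeZero n := ⟨hn.ne'⟩
  obtain ⟨δ, hδ, hzδ, hnhds⟩ := exists_separated_mem_nhdsWithin hz hi
  obtain ⟨L, hL, hG⟩ := exists_lipschitz_cellGrad (n := n) hρ hδ
  set T := ∫ w in disk, ρ w with hT
  have hT0 : 0 ≤ T := setIntegral_nonneg measurableSet_disk fun w hw => (hρ.pos w hw).le
  refine HasFDerivWithinAt.of_isLittleO (Asymptotics.IsBigO.trans_isLittleO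
    (g := fun y => ‖y - z‖ ^ 2) ?_
    ((Asymptotics.isLittleO_pow_sub_sub z (by norm_num)).mono nhdsWithin_le_nhds))
  refine Asymptotics.IsBigO.of_bound (n * (2 * L + T)) ?_
  filter_upwards [hnhds] with y hy
  rw [norm_pow, norm_norm, costDeriv_apply, Real.norm_eq_abs, abs_le]
  have hh : ∀ i, ‖y i - z i‖ ≤ ‖y - z‖ := fun i => norm_le_pi_norm (y - z) i
  have hM : ∀ x : Fin n → E2, ∀ i, cellMass ρ x i * ‖y i - z i‖ ^ 2 ≤ T * ‖y - z‖ ^ 2 :=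
    fun x i => mul_le_mul (cellMass_le hρ x i) (by gcongr; exact hh i) (by positivity) hT0
  have hsum : ∀ a b : Fin n → ℝ, (∀ i, a i ≤ b i + (2 * L + T) * ‖y - z‖ ^ 2) →
      ∑ i, a i ≤ ∑ i, b i + n * (2 * L + T) * ‖y - z‖ ^ 2 := fun a b hab => by
    refine (Finset.sum_le_sum fun i _ => hab i).trans (le_of_eq ?_)
    rw [Finset.sum_add_distrib, Finset.sum_const, Finset.card_univ, Fintype.card_fin,
      nsmul_eq_mul, mul_assoc]
  -- The bound from `z` to `y` gives the upper estimate. The bound from `y` to `z` gives the lower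
  -- one, with the gradient at `y`, which `hG` exchanges for the gradient at `z` at the price of a
  -- quadratic error.
  have h1 := planarCost_sub_le hρ hz hi y
  have h2 := planarCost_sub_le hρ (separated_subset_diskConfigs δ hy)
    (injective_of_mem_separated hδ hy) z
  have h3 := hsum _ (fun i => 2 * ⟪cellGrad ρ z i, (y - z) i⟫) (fun i => by
    have := hM z i
    have h0 : 0 ≤ L * ‖y - z‖ ^ 2 := by positivity
    rw [Pi.sub_apply]
    linarith) |> h1.trans
  have h4 := hsum _ (fun i => -(2 * ⟪cellGrad ρ z i, (y - z) i⟫)) (fun i => by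
    have h5 := hM y i
    have h6 : ⟪cellGrad ρ z i - cellGrad ρ y i, y i - z i⟫ ≤ L * ‖y - z‖ * ‖y - z‖ := by
      refine (real_inner_le_norm _ _).trans
        (mul_le_mul ?_ (hh i) (norm_nonneg _) (by positivity))
      rw [norm_sub_rev y z]
      exact hG z hzδ y hy i
    rw [inner_sub_left] at h6
    rw [norm_sub_rev, ← neg_sub (y i) (z i), inner_neg_right, Pi.sub_apply]
    linarith) |> h2.trans
  rw [Finset.sum_neg_distrib] at h4
  constructor <;> linarith

end

/-! ### Lower bounds for the decay rate away from centroidal configurations -/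

section

variable {n : ℕ} {ρ : E2 → ℝ} {k : Fin n → ℝ}

/-- The rate at which the cost decreases along the control law with gains `k`. -/
def decayRate (ρ : E2 → ℝ) (k : Fin n → ℝ) (z : Fin n → E2) : ℝ :=
  ∑ i, 2 * k i * (cellMass ρ z i * ‖z i - cellCenter ρ z i‖ ^ 2)

/-- The centroidal Voronoi configurations in the disk. -/
def planarCentroidal (ρ : E2 → ℝ) (n : ℕ) : Set (Fin n → E2) :=
  {z | z ∈ diskConfigs n ∧ Function.Injective z ∧ ∀ i, z i = cellCenter ρ z i}

theorem decayRate_term_nonneg (hρ : IsDensity ρ) (hk : ∀ i, 0 < k i) {z : Fin n → E2}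
    (hz : z ∈ diskConfigs n) (i : Fin n) :
    0 ≤ 2 * k i * (cellMass ρ z i * ‖z i - cellCenter ρ z i‖ ^ 2) := by
  have := cellMass_pos hρ (mem_diskConfigs.1 hz i)
  have := hk i
  positivity

theorem decayRate_nonneg (hρ : IsDensity ρ) (hk : ∀ i, 0 < k i) {z : Fin n → E2}
    (hz : z ∈ diskConfigs n) : 0 ≤ decayRate ρ k z :=
  Finset.sum_nonneg fun i _ => decayRate_term_nonneg hρ hk hz i

theorem decayRate_eq_zero_iff (hρ : IsDensity ρ) (hk : ∀ i, 0 < k i) {z : Fin n → E2}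
    (hz : z ∈ diskConfigs n) : decayRate ρ k z = 0 ↔ ∀ i, z i = cellCenter ρ z i := by
  rw [decayRate, Finset.sum_eq_zero_iff_of_nonneg fun i _ => decayRate_term_nonneg hρ hk hz i]
  refine ⟨fun h i => ?_, fun h i _ => ?_⟩
  · have h1 := h i (Finset.mem_univ i)
    have h2 := (cellMass_pos hρ (mem_diskConfigs.1 hz i)).ne'
    have h3 := (hk i).ne'
    simpa [h2, h3, sub_eq_zero] using h1
  · rw [← h i]
    simp

theorem continuousWithinAt_decayRate (hρ : IsDensity ρ) {z : Fin n → E2} (hz : z ∈ diskConfigs n)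
    (hi : Function.Injective z) : ContinuousWithinAt (decayRate ρ k) (diskConfigs n) z := by
  unfold decayRate
  refine tendsto_finsetSum _ fun i _ => ContinuousWithinAt.mul continuousWithinAt_const
    ((continuousWithinAt_cellMass hρ hz hi i).mul (ContinuousWithinAt.pow
      (ContinuousWithinAt.norm ((continuous_apply i).continuousWithinAt.sub
        (continuousWithinAt_cellCenter hρ hz hi i))) 2))

theorem IsDensity.integral_pos (hρ : IsDensity ρ) : 0 < ∫ w in disk, ρ w := by
  obtain ⟨m, hm0, hm⟩ := hρ.exists_lower_bound
  have h := mul_volume_le_setIntegral hρ hm Subset.rfl Subset.rfl measurableSet_disk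
    measurableSet_disk
  exact (mul_pos hm0 (volume_real_closedBall_pos one_pos)).trans_le h

/-- A Voronoi cell lies on one side of each bisector, so that its center of mass stays away from
the bisector if the cell is not too small. -/
theorem le_norm_sub_cellCenter (hρ : IsDensity ρ) {m : ℝ} (hm0 : 0 < m)
    (hm : ∀ w ∈ disk, m ≤ ρ w) {z : Fin n → E2} {i j : Fin n} (hz : z i ∈ disk) (hij : z i ≠ z j)
    {α : ℝ} (hα : 0 < α) (hV : α ≤ volume.real (voronoiCell z i)) :
    m * α ^ 2 / (8 * ∫ w in disk, ρ w) - ‖z i - z j‖ / 2 ≤ ‖z i - cellCenter ρ z i‖ := by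
  set T := ∫ w in disk, ρ w with hT
  have hT0 : 0 < T := hρ.integral_pos
  set v := z i - z j with hv
  have hv0 : 0 < ‖v‖ := norm_pos_iff.2 (sub_ne_zero.2 hij)
  set c := (‖z i‖ ^ 2 - ‖z j‖ ^ 2) / 2 with hc
  -- Chosen so that the part of the disk within `h / ‖v‖` of the bisector, on the side of the cell,
  -- has area at most `α / 2`. At least half of the area `α` then lies farther away.
  set h := ‖v‖ * α / 4 with hh
  have hh0 : 0 < h := by positivity
  have hVd := voronoiCell_subset_disk z i
  set S := {w : E2 | w ∈ disk ∧ c ≤ ⟪v, w⟫ ∧ ⟪v, w⟫ ≤ c + h} with hS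
  have hvc : Continuous fun w : E2 => ⟪v, w⟫ := by fun_prop
  have hSm : MeasurableSet S := measurableSet_disk.inter
    ((isClosed_le continuous_const hvc).inter (isClosed_le hvc continuous_const)).measurableSet
  have hSv : volume.real S ≤ α / 2 := by
    refine ENNReal.toReal_le_of_le_ofReal (by positivity) ?_
    refine (volume_disk_inter_slab_le (sub_ne_zero.2 hij) c (c + h)).trans
      (ENNReal.ofReal_le_ofReal (le_of_eq ?_))
    rw [hh, ← hv]
    field_simp
    ring
  have hside : ∀ w ∈ voronoiCell z i, 0 ≤ ⟪v, w⟫ - c := fun w hw => by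
    have := (norm_sub_le_norm_sub_iff _ _ _).1 (hw.2 j)
    linarith
  have h1 : α / 2 ≤ volume.real (voronoiCell z i \ S) := by
    have := le_measureReal_sdiff (μ := volume) (s₁ := voronoiCell z i) (s₂ := S)
      (h := volume_ne_top_of_subset_disk fun w hw => hw.1)
    linarith
  have hint : IntegrableOn (fun w => ρ w * (⟪v, w⟫ - c)) (voronoiCell z i) :=
    integrableOn_of_subset_disk (hρ.continuousOn.mul (by fun_prop)) hVd
  have h2 : m * h * volume.real (voronoiCell z i \ S) ≤
      cellMass ρ z i * (⟪v, cellCenter ρ z i⟫ - c) := by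
    rw [cellMass_mul_inner_cellCenter_sub hρ hz]
    calc m * h * volume.real (voronoiCell z i \ S)
        = ∫ _w in voronoiCell z i \ S, m * h := by simp [mul_comm]
      _ ≤ ∫ w in voronoiCell z i \ S, ρ w * (⟪v, w⟫ - c) := by
          refine setIntegral_mono_on (integrableOn_const
            (volume_ne_top_of_subset_disk (sdiff_subset.trans hVd)))
            (hint.mono_set sdiff_subset) ((measurableSet_voronoiCell z i).diff hSm)
            fun w hw => ?_
          refine mul_le_mul (hm w hw.1.1) ?_ hh0.le (hρ.pos w hw.1.1).le
          by_contra hlt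
          exact hw.2 ⟨hw.1.1, by linarith [hside w hw.1], by linarith⟩
      _ ≤ ∫ w in voronoiCell z i, ρ w * (⟪v, w⟫ - c) :=
          setIntegral_mono_set hint ((ae_restrict_iff' (measurableSet_voronoiCell z i)).2
            (Eventually.of_forall fun w hw => mul_nonneg (hρ.pos w hw.1).le (hside w hw)))
            (LE.le.eventuallyLE sdiff_subset)
  have h3 : m * h * (α / 2) ≤ T * (⟪v, cellCenter ρ z i⟫ - c) := by
    refine (mul_le_mul_of_nonneg_left h1 (by positivity)).trans (h2.trans ?_)
    exact mul_le_mul_of_nonneg_right (cellMass_le hρ z i)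
      (hside _ (cellCenter_mem_voronoiCell hρ hz))
  have h4 : c = ⟪v, z i⟫ - ‖v‖ ^ 2 / 2 := by
    rw [hc, hv, norm_sub_sq_real, inner_sub_left, real_inner_self_eq_norm_sq,
      real_inner_comm (z i) (z j)]
    ring
  have h5 : ⟪v, cellCenter ρ z i⟫ - ⟪v, z i⟫ ≤ ‖v‖ * ‖z i - cellCenter ρ z i‖ := by
    rw [← inner_sub_right, norm_sub_rev (z i) (cellCenter ρ z i)]
    exact real_inner_le_norm _ _
  have h6 : m * h * (α / 2) ≤ T * (‖v‖ * ‖z i - cellCenter ρ z i‖ + ‖v‖ ^ 2 / 2) :=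
    h3.trans (mul_le_mul_of_nonneg_left (by linarith) hT0.le)
  have h7 : m * α ^ 2 / 8 ≤ T * (‖z i - cellCenter ρ z i‖ + ‖v‖ / 2) := by
    refine le_of_mul_le_mul_left ?_ hv0
    calc ‖v‖ * (m * α ^ 2 / 8) = m * h * (α / 2) := by rw [hh]; ring
      _ ≤ _ := h6
      _ = _ := by ring
  have h8 : m * α ^ 2 / (8 * T) ≤ ‖z i - cellCenter ρ z i‖ + ‖v‖ / 2 := by
    rw [div_le_iff₀ (by positivity)]
    linarith
  linarith

theorem exists_pos_le (hk : ∀ i, 0 < k i) : ∃ κ, 0 < κ ∧ ∀ i, κ ≤ k i := by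
  rcases isEmpty_or_nonempty (Fin n) with h | h
  · exact ⟨1, one_pos, fun i => isEmptyElim i⟩
  · obtain ⟨i, hi⟩ := Finite.exists_min k
    exact ⟨k i, hk i, hi⟩

/-- Near a configuration in which some points coincide, the decay rate at configurations of
distinct points is bounded below. -/
theorem exists_le_decayRate_of_not_injective (hρ : IsDensity ρ) (hk : ∀ i, 0 < k i)
    {x : Fin n → E2} (hx : x ∈ diskConfigs n) (hi : ¬ Function.Injective x) :
    ∃ η, 0 < η ∧ ∀ᶠ z in 𝓝[diskConfigs n] x, Function.Injective z → η ≤ decayRate ρ k z := by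
  classical
  obtain ⟨a, b, hxab, hab⟩ : ∃ a b, x a = x b ∧ a ≠ b := by
    simpa [Function.Injective] using hi
  have hn : 0 < (n : ℝ) := Nat.cast_pos.2 (Fin.pos a)
  obtain ⟨m, hm0, hm⟩ := hρ.exists_lower_bound
  obtain ⟨κ, hκ0, hκ⟩ := exists_pos_le hk
  obtain ⟨r, hr0, hr1, hr⟩ := exists_radius x a
  set A := Metric.closedBall ((1 - r / 2 / 2) • x a) (r / 2 / 2) with hA
  have hAsub : A ⊆ disk ∩ Metric.closedBall (x a) (r / 2) :=
    closedBall_subset_disk_inter_closedBall (mem_diskConfigs.1 hx a) (by linarith) (by linarith)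
  set S : Finset (Fin n) := Finset.univ.filter fun i => x i = x a with hS
  have hA0 : 0 < volume.real A := by
    rw [hA, Measure.addHaar_real_closedBall_center]
    exact volume_real_closedBall_pos (by linarith)
  -- At most `n` cells of the cluster cover `A`, so one of them has at least this area.
  set α := volume.real A / n with hα
  have hα0 : 0 < α := by positivity
  set T := ∫ w in disk, ρ w with hT
  have hT0 : 0 < T := hρ.integral_pos
  set θ := m * α ^ 2 / (8 * T) with hθ
  have hθ0 : 0 < θ := by positivity
  refine ⟨2 * κ * (m * α * (θ / 2) ^ 2), by positivity, ?_⟩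
  have hε : 0 < min (r / 4) (θ / 2) := by positivity
  filter_upwards [mem_nhdsWithin_of_mem_nhds (Metric.closedBall_mem_nhds x hε),
    self_mem_nhdsWithin] with z hzx hz hzi
  have hzx' : ∀ i, ‖z i - x i‖ ≤ min (r / 4) (θ / 2) := fun i =>
    (norm_le_pi_norm (z - x) i).trans (mem_closedBall_iff_norm.1 hzx)
  -- Points of `A` are within `3 * r / 4` of `z a`, whereas generators outside the cluster have
  -- limits at distance at least `2 * r` from `x a`. The nearest generator therefore belongs to the
  -- cluster.
  have hcover : A ⊆ ⋃ i ∈ S, voronoiCell z i := by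
    intro w hw
    obtain ⟨hwd, hwa⟩ := hAsub hw
    rw [mem_closedBall_iff_norm] at hwa
    have : Nonempty (Fin n) := ⟨a⟩
    obtain ⟨i, hi⟩ := Finite.exists_min fun j => ‖w - z j‖
    refine mem_biUnion (x := i) ?_ ⟨hwd, hi⟩
    have h1 : ‖w - z i‖ ≤ r / 2 + r / 4 := by
      refine (hi a).trans ((norm_sub_le_norm_sub_add_norm_sub w (x a) (z a)).trans ?_)
      rw [norm_sub_rev (x a)]
      exact add_le_add hwa ((hzx' a).trans (min_le_left _ _))
    rcases hr i with h | h
    · simp [hS, h]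
    · have h2 : ‖x a - x i‖ ≤ ‖w - x a‖ + ‖w - z i‖ + ‖z i - x i‖ := by
        rw [norm_sub_rev w (x a)]
        refine (norm_sub_le_norm_sub_add_norm_sub (x a) w (x i)).trans ?_
        rw [add_assoc]
        gcongr
        exact norm_sub_le_norm_sub_add_norm_sub _ _ _
      linarith [(hzx' i).trans (min_le_left _ _)]
  obtain ⟨i, hiS, hi⟩ : ∃ i ∈ S, α ≤ volume.real (voronoiCell z i) := by
    by_contra! hlt
    have h1 : volume.real A ≤ ∑ i ∈ S, volume.real (voronoiCell z i) :=
      (measureReal_mono hcover (by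
        refine volume_ne_top_of_subset_disk (iUnion₂_subset fun i _ =>
          voronoiCell_subset_disk z i))).trans (measureReal_biUnion_finset_le _ _)
    have h2 : ∑ i ∈ S, volume.real (voronoiCell z i) < ∑ _i ∈ S, α :=
      Finset.sum_lt_sum_of_nonempty ⟨a, by simp [hS]⟩ hlt
    rw [Finset.sum_const, nsmul_eq_mul] at h2
    have h3 : (S.card : ℝ) ≤ n := by
      exact_mod_cast (Finset.card_le_univ S).trans_eq (Fintype.card_fin n)
    have h4 : (S.card : ℝ) * α ≤ n * α := by gcongr
    rw [hα, mul_div_cancel₀ _ hn.ne', ← hα] at h4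
    linarith
  obtain ⟨j, hj, hij⟩ : ∃ j, x j = x a ∧ i ≠ j := by
    by_cases h : i = a
    · exact ⟨b, hxab.symm, by rw [h]; exact hab⟩
    · exact ⟨a, rfl, h⟩
  have hix : x i = x a := by simpa [hS] using hiS
  have hzij : ‖z i - z j‖ ≤ θ := by
    have e : z i - z j = (z i - x i) - (z j - x j) := by rw [hix, hj]; abel
    rw [e]
    refine (norm_sub_le _ _).trans ?_
    linarith [(hzx' i).trans (min_le_right _ _), (hzx' j).trans (min_le_right _ _)]
  have hzd := mem_diskConfigs.1 hz i
  have h1 := le_norm_sub_cellCenter hρ hm0 hm hzd (hzi.ne hij) hα0 hi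
  have h2 : θ / 2 ≤ ‖z i - cellCenter ρ z i‖ := by linarith
  have h3 : m * α ≤ cellMass ρ z i := (mul_le_mul_of_nonneg_left hi hm0.le).trans
    (mul_volume_le_setIntegral hρ hm Subset.rfl (voronoiCell_subset_disk z i)
      (measurableSet_voronoiCell z i) (measurableSet_voronoiCell z i))
  have h4 := Finset.single_le_sum (fun i _ => decayRate_term_nonneg hρ hk hz i)
    (Finset.mem_univ i)
  refine le_trans ?_ h4
  have h5 := (hk i).le
  have h6 := (cellMass_pos hρ hzd).le
  have h7 := hκ i
  gcongr

theorem exists_le_decayRate_near (hρ : IsDensity ρ) (hk : ∀ i, 0 < k i)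
    {x : Fin n → E2} (hx : x ∈ diskConfigs n) (hxc : x ∉ planarCentroidal ρ n) :
    ∃ η, 0 < η ∧ ∀ᶠ z in 𝓝[diskConfigs n] x, Function.Injective z → η ≤ decayRate ρ k z := by
  by_cases hi : Function.Injective x
  · have hpos : 0 < decayRate ρ k x := (decayRate_nonneg hρ hk hx).lt_of_ne fun h =>
      hxc ⟨hx, hi, (decayRate_eq_zero_iff hρ hk hx).1 h.symm⟩
    refine ⟨decayRate ρ k x / 2, by linarith, ?_⟩
    filter_upwards [(continuousWithinAt_decayRate hρ hx hi).eventually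
      (lt_mem_nhds (half_lt_self hpos))] with z hz _
    exact hz.le
  · exact exists_le_decayRate_of_not_injective hρ hk hx hi

theorem isCompact_diskConfigs : IsCompact (diskConfigs n) :=
  isCompact_univ_pi fun _ => isCompact_disk

/-- The decay rate vanishes on centroidal configurations but is bounded below at distinct points
near any other configuration. In particular, centroidal configurations cannot accumulate at a
collision. The unit gains are auxiliary. -/
theorem isCompact_planarCentroidal (hρ : IsDensity ρ) : IsCompact (planarCentroidal ρ n) := by
  refine isCompact_diskConfigs.of_isClosed_subset ?_ fun z hz => hz.1
  have hk : ∀ i : Fin n, 0 < (fun _ => 1 : Fin n → ℝ) i := fun _ => one_pos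
  rw [← isOpen_compl_iff, isOpen_iff_mem_nhds]
  intro x hx
  by_cases hxd : x ∈ diskConfigs n
  · obtain ⟨η, hη, h⟩ := exists_le_decayRate_near hρ hk hxd hx
    filter_upwards [eventually_nhdsWithin_iff.1 h] with z hz hzc
    have h1 := hz hzc.1 hzc.2.1
    rw [(decayRate_eq_zero_iff hρ hk hzc.1).2 hzc.2.2] at h1
    linarith
  · filter_upwards [isCompact_diskConfigs.isClosed.isOpen_compl.mem_nhds hxd] with z hz hzc
    exact hz hzc.1

theorem exists_le_decayRate (hρ : IsDensity ρ) (hk : ∀ i, 0 < k i) {U : Set (Fin n → E2)}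
    (hU : IsOpen U) (hKU : planarCentroidal ρ n ⊆ U) :
    ∃ η, 0 < η ∧ ∀ z ∈ diskConfigs n \ U, Function.Injective z → η ≤ decayRate ρ k z := by
  refine (isCompact_diskConfigs.diff hU).induction_on (p := fun s => ∃ η, 0 < η ∧
    ∀ z ∈ s, z ∈ diskConfigs n → Function.Injective z → η ≤ decayRate ρ k z)
    ⟨1, one_pos, fun z hz => hz.elim⟩ ?_ ?_ ?_ |>.imp fun η h =>
      ⟨h.1, fun z hz => h.2 z hz hz.1⟩
  · rintro s t hst ⟨η, hη, h⟩
    exact ⟨η, hη, fun z hz => h z (hst hz)⟩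
  · rintro s t ⟨η, hη, h⟩ ⟨η', hη', h'⟩
    refine ⟨min η η', lt_min hη hη', ?_⟩
    rintro z (hz | hz) hzd hzi
    · exact (min_le_left _ _).trans (h z hz hzd hzi)
    · exact (min_le_right _ _).trans (h' z hz hzd hzi)
  · intro x hx
    obtain ⟨η, hη, h⟩ := exists_le_decayRate_near hρ hk hx.1 fun h => hx.2 (hKU h)
    exact ⟨_, mem_nhdsWithin_of_mem_nhds (eventually_nhdsWithin_iff.1 h),
      η, hη, fun z hz => hz⟩

end

/-! ### The planar control law: invariance tools, absence of collisions, uniqueness -/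

section

variable {n : ℕ} {ρ : E2 → ℝ} {k : Fin n → ℝ}

theorem exists_nearest_disk (x : E2) : ∃ p ∈ disk, ∀ w ∈ disk, ⟪x - p, w - p⟫ ≤ 0 := by
  obtain ⟨p, hp, h⟩ := exists_norm_eq_iInf_of_complete_convex (K := disk) ⟨0, by simp [disk]⟩
    isCompact_disk.isClosed.isComplete convex_disk x
  exact ⟨p, hp, (norm_eq_iInf_iff_real_inner_le_zero convex_disk hp).1 h⟩

/-- The nearest-point retraction of the plane onto the disk. -/
def diskProj (x : E2) : E2 := (exists_nearest_disk x).choose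

theorem diskProj_mem (x : E2) : diskProj x ∈ disk := (exists_nearest_disk x).choose_spec.1

theorem inner_sub_diskProj_le (x : E2) {w : E2} (hw : w ∈ disk) :
    ⟪x - diskProj x, w - diskProj x⟫ ≤ 0 := (exists_nearest_disk x).choose_spec.2 w hw

theorem diskProj_of_mem {x : E2} (hx : x ∈ disk) : diskProj x = x := by
  have h := inner_sub_diskProj_le x hx
  rw [real_inner_self_nonpos, sub_eq_zero] at h
  exact h.symm

theorem lipschitzWith_diskProj : LipschitzWith 1 diskProj := by
  refine LipschitzWith.of_dist_le_mul fun x y => ?_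
  rw [NNReal.coe_one, one_mul, dist_eq_norm, dist_eq_norm]
  have h1 := inner_sub_diskProj_le x (diskProj_mem y)
  have h2 := inner_sub_diskProj_le y (diskProj_mem x)
  set p := diskProj x
  set q := diskProj y
  -- Sum of the two variational inequalities that characterize the nearest points.
  have h3 : ‖p - q‖ * ‖p - q‖ ≤ ⟪x - y, p - q⟫ := by
    rw [← real_inner_self_eq_norm_mul_norm]
    have e : ⟪x - y, p - q⟫ = ⟪p - q, p - q⟫ - ⟪x - p, q - p⟫ - ⟪y - q, p - q⟫ := by
      rw [← neg_sub p q, inner_neg_right, sub_neg_eq_add, ← inner_add_left, ← inner_sub_left]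
      congr 1
      abel
    linarith
  have h4 := h3.trans (real_inner_le_norm _ _)
  by_contra hlt
  push Not at hlt
  nlinarith [norm_nonneg (x - y), norm_nonneg (p - q)]

/-- The control law in the disk. -/
def planarField (ρ : E2 → ℝ) (k : Fin n → ℝ) (z : Fin n → E2) : Fin n → E2 :=
  fun i => -(k i) • (z i - cellCenter ρ z i)

/-- `z` solves the control law in the disk on the time interval `s`. -/
structure IsPlanarSolution (ρ : E2 → ℝ) (k : Fin n → ℝ) (z : ℝ → Fin n → E2) (s : Set ℝ) :
    Prop where
  mem : ∀ t ∈ s, z t ∈ diskConfigs n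
  hasDeriv : ∀ t ∈ s, HasDerivWithinAt z (planarField ρ k (z t)) s t

theorem IsPlanarSolution.continuousOn {z : ℝ → Fin n → E2} {s : Set ℝ}
    (h : IsPlanarSolution ρ k z s) : ContinuousOn z s :=
  fun t ht => (h.hasDeriv t ht).continuousWithinAt

theorem IsPlanarSolution.mono {z : ℝ → Fin n → E2} {s t : Set ℝ}
    (h : IsPlanarSolution ρ k z s) (hts : t ⊆ s) : IsPlanarSolution ρ k z t :=
  ⟨fun u hu => h.mem u (hts hu), fun u hu => (h.hasDeriv u (hts hu)).mono hts⟩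

/-- With `v = z i - z j`, the bisector is halfway between the generators. Since `C_i` stays on the
side of `z i`, the inner product of `v` with `z i - C_i` is at most `‖v‖² / 2`, and symmetrically
for `j`. Hence the rate is at least `-(k i + k j) * ‖v‖²`. -/
theorem neg_mul_norm_sq_le_inner_planarField (hρ : IsDensity ρ) (hk : ∀ i, 0 < k i)
    {z : Fin n → E2} (hz : z ∈ diskConfigs n) (i j : Fin n) :
    -(2 * ∑ l, k l) * ‖z i - z j‖ ^ 2 ≤
      2 * ⟪z i - z j, planarField ρ k z i - planarField ρ k z j⟫ := by
  have hi := (norm_sub_le_norm_sub_iff _ _ _).1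
    ((cellCenter_mem_voronoiCell hρ (mem_diskConfigs.1 hz i)).2 j)
  have hj := (norm_sub_le_norm_sub_iff _ _ _).1
    ((cellCenter_mem_voronoiCell hρ (mem_diskConfigs.1 hz j)).2 i)
  rw [← neg_sub (z i) (z j), inner_neg_left] at hj
  have hki : k i ≤ ∑ l, k l := Finset.single_le_sum (fun l _ => (hk l).le) (Finset.mem_univ i)
  have hkj : k j ≤ ∑ l, k l := Finset.single_le_sum (fun l _ => (hk l).le) (Finset.mem_univ j)
  set v := z i - z j with hv
  have h1 : ⟪v, z i⟫ = (‖z i‖ ^ 2 - ‖z j‖ ^ 2) / 2 + ‖v‖ ^ 2 / 2 := by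
    rw [hv, norm_sub_sq_real, inner_sub_left, real_inner_self_eq_norm_sq,
      real_inner_comm (z i) (z j)]
    ring
  have h2 : ⟪v, z j⟫ = (‖z i‖ ^ 2 - ‖z j‖ ^ 2) / 2 - ‖v‖ ^ 2 / 2 := by
    rw [hv, norm_sub_sq_real, inner_sub_left, real_inner_self_eq_norm_sq]
    ring
  simp only [planarField]
  rw [inner_sub_right, real_inner_smul_right, real_inner_smul_right, inner_sub_right,
    inner_sub_right, h1, h2]
  have h3 : 0 ≤ k i * (⟪v, cellCenter ρ z i⟫ - (‖z i‖ ^ 2 - ‖z j‖ ^ 2) / 2) :=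
    mul_nonneg (hk i).le (by linarith)
  have h4 : 0 ≤ k j * ((‖z i‖ ^ 2 - ‖z j‖ ^ 2) / 2 - ⟪v, cellCenter ρ z j⟫) :=
    mul_nonneg (hk j).le (by linarith)
  have h5 := mul_le_mul_of_nonneg_right hki (sq_nonneg ‖v‖)
  have h6 := mul_le_mul_of_nonneg_right hkj (sq_nonneg ‖v‖)
  linarith

/-- Along solutions the points do not approach each other faster than exponentially. -/
theorem exp_mul_norm_sub_le (hρ : IsDensity ρ) (hk : ∀ i, 0 < k i) {z : ℝ → Fin n → E2} {T : ℝ}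
    (hT : 0 ≤ T) (hc : ContinuousOn z (Icc 0 T)) (hd : ∀ t ∈ Ioo 0 T, z t ∈ diskConfigs n)
    (hz : ∀ t ∈ Ioo 0 T, HasDerivAt z (planarField ρ k (z t)) t) (i j : Fin n) :
    Real.exp (-(∑ l, k l) * T) * ‖z 0 i - z 0 j‖ ≤ ‖z T i - z T j‖ := by
  set κ := ∑ l, k l with hκ
  have hmono : MonotoneOn (fun t => Real.exp (2 * κ * t) * ‖z t i - z t j‖ ^ 2) (Icc 0 T) := by
    refine monotoneOn_of_hasDerivWithinAt_nonneg (convex_Icc 0 T)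
      (f' := fun t => Real.exp (2 * κ * t) * (2 * κ) * ‖z t i - z t j‖ ^ 2 + Real.exp (2 * κ * t) *
        (2 * ⟪z t i - z t j, planarField ρ k (z t) i - planarField ρ k (z t) j⟫)) ?_ ?_ ?_
    · exact ContinuousOn.mul (Continuous.continuousOn (by fun_prop))
        (((continuousOn_pi.1 hc i).sub (continuousOn_pi.1 hc j)).norm.pow 2)
    · rw [interior_Icc]
      intro t ht
      have h1 : HasDerivAt (fun t => Real.exp (2 * κ * t)) (Real.exp (2 * κ * t) * (2 * κ)) t := by
        simpa using ((hasDerivAt_id t).const_mul (2 * κ)).exp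
      have h2 := hasDerivAt_pi.1 (hz t ht)
      exact (h1.mul ((h2 i).sub (h2 j)).norm_sq).hasDerivWithinAt
    · rw [interior_Icc]
      intro t ht
      have h := neg_mul_norm_sq_le_inner_planarField hρ hk (hd t ht) i j
      rw [mul_assoc, ← mul_add]
      exact mul_nonneg (Real.exp_pos _).le (by linarith)
  have h := hmono (left_mem_Icc.2 hT) (right_mem_Icc.2 hT) hT
  simp only [mul_zero, Real.exp_zero, one_mul] at h
  have h2 : Real.exp (-κ * T) ^ 2 * Real.exp (2 * κ * T) = 1 := by
    rw [sq, ← Real.exp_add, ← Real.exp_add, Real.exp_eq_one_iff]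
    ring
  refine le_of_sq_le_sq ?_ (norm_nonneg _)
  calc (Real.exp (-κ * T) * ‖z 0 i - z 0 j‖) ^ 2
      = Real.exp (-κ * T) ^ 2 * ‖z 0 i - z 0 j‖ ^ 2 := mul_pow _ _ _
    _ ≤ Real.exp (-κ * T) ^ 2 * (Real.exp (2 * κ * T) * ‖z T i - z T j‖ ^ 2) := by gcongr
    _ = ‖z T i - z T j‖ ^ 2 := by rw [← mul_assoc, h2, one_mul]

theorem IsPlanarSolution.exp_mul_le (hρ : IsDensity ρ) (hk : ∀ i, 0 < k i)
    {z : ℝ → Fin n → E2} {T : ℝ} (h : IsPlanarSolution ρ k z (Icc 0 T)) {t : ℝ}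
    (ht : t ∈ Icc 0 T) (i j : Fin n) :
    Real.exp (-(∑ l, k l) * t) * ‖z 0 i - z 0 j‖ ≤ ‖z t i - z t j‖ := by
  have hs : Icc 0 t ⊆ Icc 0 T := Icc_subset_Icc_right ht.2
  refine exp_mul_norm_sub_le hρ hk ht.1 ((h.mono hs).continuousOn)
    (fun u hu => h.mem u (hs (Ioo_subset_Icc_self hu))) (fun u hu => ?_) i j
  exact ((h.mono hs).hasDeriv u (Ioo_subset_Icc_self hu)).hasDerivAt (Icc_mem_nhds hu.1 hu.2)

theorem IsPlanarSolution.injective (hρ : IsDensity ρ) (hk : ∀ i, 0 < k i)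
    {z : ℝ → Fin n → E2} {T : ℝ} (h : IsPlanarSolution ρ k z (Icc 0 T))
    (hi : Function.Injective (z 0)) {t : ℝ} (ht : t ∈ Icc 0 T) : Function.Injective (z t) := by
  intro i j hij
  by_contra hne
  have h1 := h.exp_mul_le hρ hk ht i j
  rw [hij, sub_self, norm_zero] at h1
  have h2 : 0 < ‖z 0 i - z 0 j‖ := norm_pos_iff.2 (sub_ne_zero.2 (hi.ne hne))
  linarith [mul_pos (Real.exp_pos (-(∑ l, k l) * t)) h2]

theorem sum_gain_nonneg (hk : ∀ i, 0 < k i) : 0 ≤ ∑ l, k l :=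
  Finset.sum_nonneg fun i _ => (hk i).le

theorem exp_neg_mul_anti (hk : ∀ i, 0 < k i) {t T : ℝ} (ht : t ≤ T) :
    Real.exp (-(∑ l, k l) * T) ≤ Real.exp (-(∑ l, k l) * t) :=
  Real.exp_le_exp.2 (by nlinarith [sum_gain_nonneg hk])

theorem IsPlanarSolution.mem_separated (hρ : IsDensity ρ) (hk : ∀ i, 0 < k i)
    {z : ℝ → Fin n → E2} {T : ℝ} (h : IsPlanarSolution ρ k z (Icc 0 T)) {δ : ℝ} (hδ : 0 ≤ δ)
    (h0 : z 0 ∈ separated n δ) {t : ℝ} (ht : t ∈ Icc 0 T) :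
    z t ∈ separated n (Real.exp (-(∑ l, k l) * T) * δ) := by
  refine ⟨mem_diskConfigs.1 (h.mem t ht), fun i j hij => le_trans ?_ (h.exp_mul_le hρ hk ht i j)⟩
  exact mul_le_mul (exp_neg_mul_anti hk ht.2) (h0.2 i j hij) hδ (Real.exp_pos _).le

theorem exists_lipschitzOnWith_planarField (hρ : IsDensity ρ) {δ : ℝ}
    (hδ : 0 < δ) : ∃ L : ℝ≥0, LipschitzOnWith L (planarField ρ k) (separated n δ) := by
  obtain ⟨L, hL, h⟩ := exists_lipschitz_cellCenter (n := n) hρ hδ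
  refine ⟨(∑ l, ‖k l‖₊) * (1 + ⟨L, hL⟩), LipschitzOnWith.of_dist_le_mul fun z hz z' hz' => ?_⟩
  rw [dist_pi_le_iff (by positivity)]
  intro i
  have e : planarField ρ k z i - planarField ρ k z' i =
      -(k i) • ((z i - z' i) - (cellCenter ρ z i - cellCenter ρ z' i)) := by
    simp only [planarField]
    module
  rw [dist_eq_norm, dist_eq_norm, e, norm_smul, norm_neg]
  push_cast
  rw [mul_assoc]
  have h1 : ‖k i‖ ≤ ∑ l, ‖k l‖ :=
    Finset.single_le_sum (fun l _ => norm_nonneg (k l)) (Finset.mem_univ i)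
  have h2 : ‖(z i - z' i) - (cellCenter ρ z i - cellCenter ρ z' i)‖ ≤ (1 + L) * ‖z - z'‖ := by
    refine (norm_sub_le _ _).trans ?_
    have h7 : ‖z i - z' i‖ ≤ ‖z - z'‖ := norm_le_pi_norm (z - z') i
    linarith [h z hz z' hz' i]
  exact mul_le_mul h1 h2 (norm_nonneg _) (Finset.sum_nonneg fun l _ => norm_nonneg _)

/-- On a bounded time interval both solutions stay in one separated set, where the field is
Lipschitz and the standard uniqueness theorem applies. -/
theorem IsPlanarSolution.eqOn (hρ : IsDensity ρ) (hk : ∀ i, 0 < k i)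
    {z z' : ℝ → Fin n → E2} {T : ℝ} (hT : 0 ≤ T) (h : IsPlanarSolution ρ k z (Icc 0 T))
    (h' : IsPlanarSolution ρ k z' (Icc 0 T)) (h0 : z 0 = z' 0) (hi : Function.Injective (z 0)) :
    EqOn z z' (Icc 0 T) := by
  obtain ⟨δ, hδ, hzδ, -⟩ := exists_separated_mem_nhdsWithin (h.mem 0 (left_mem_Icc.2 hT)) hi
  obtain ⟨L, hL⟩ := exists_lipschitzOnWith_planarField (k := k) (n := n) hρ
    (mul_pos (Real.exp_pos (-(∑ l, k l) * T)) hδ)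
  have hder : ∀ {y : ℝ → Fin n → E2}, IsPlanarSolution ρ k y (Icc 0 T) → ∀ t ∈ Ico 0 T,
      HasDerivWithinAt y (planarField ρ k (y t)) (Ici t) t := fun hy t ht =>
    (hy.hasDeriv t (Ico_subset_Icc_self ht)).mono_of_mem_nhdsWithin (Icc_mem_nhdsGE_of_mem ht)
  exact ODE_solution_unique_of_mem_Icc_right (v := fun _ => planarField ρ k)
    (s := fun _ => separated n (Real.exp (-(∑ l, k l) * T) * δ)) (fun _ _ => hL)
    h.continuousOn (hder h) (fun t ht => h.mem_separated hρ hk hδ.le hzδ (Ico_subset_Icc_self ht))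
    h'.continuousOn (hder h')
    (fun t ht => h'.mem_separated hρ hk hδ.le (h0 ▸ hzδ) (Ico_subset_Icc_self ht)) h0

end

/-! ### Existence of planar solutions -/

section

variable {n : ℕ} {ρ : E2 → ℝ} {k : Fin n → ℝ}

/-- Points that are attracted to targets in the disk, which depend on the configuration in a
Lipschitz way, can be followed for all times, and stay in the disk. -/
theorem exists_solution_of_lipschitz (hk : ∀ i, 0 < k i) {C : (Fin n → E2) → Fin n → E2} {L : ℝ≥0}
    (hC : LipschitzWith L C) (hCd : ∀ z i, C z i ∈ disk) {x : Fin n → E2} (hx : x ∈ diskConfigs n)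
    {T : ℝ} (hT : 0 ≤ T) :
    ∃ z : ℝ → Fin n → E2, z 0 = x ∧ ∀ t ∈ Icc 0 T, z t ∈ diskConfigs n ∧
      HasDerivWithinAt z (fun i => -(k i) • (z t i - C (z t) i)) (Icc 0 T) t := by
  set κ := ∑ l, k l with hκ
  have hκ0 : 0 ≤ κ := sum_gain_nonneg hk
  have hki : ∀ i, k i ≤ κ := fun i =>
    Finset.single_le_sum (fun l _ => (hk l).le) (Finset.mem_univ i)
  set b : ℝ := κ * Real.exp (κ * T) with hb
  have hb0 : 0 ≤ b := by positivity
  obtain ⟨B, hB⟩ : ∃ B : ℝ≥0, (B : ℝ) = b := ⟨⟨b, hb0⟩, rfl⟩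
  obtain ⟨τ, hτ⟩ : ∃ τ : ℝ≥0, (τ : ℝ) = T := ⟨⟨T, hT⟩, rfl⟩
  -- Variation of constants: `y_i = exp (k_i t) z_i` removes the linear term. The remaining field
  -- `F` is bounded by `b` on the whole space, so one Picard–Lindelöf step with radius `b * T`
  -- covers all of `[0, T]`.
  let S : ℝ → (Fin n → E2) → Fin n → E2 := fun t y j => Real.exp (-(k j * t)) • y j
  let F : ℝ → (Fin n → E2) → Fin n → E2 := fun t y i => (k i * Real.exp (k i * t)) • C (S t y) i
  have hgain : ∀ t ∈ Icc 0 T, ∀ i, ‖k i * Real.exp (k i * t)‖ ≤ b := by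
    intro t ht i
    rw [Real.norm_of_nonneg (mul_nonneg (hk i).le (Real.exp_pos _).le)]
    refine mul_le_mul (hki i) (Real.exp_le_exp.2 ?_) (Real.exp_pos _).le hκ0
    exact mul_le_mul (hki i) ht.2 ht.1 hκ0
  have hF : IsPicardLindelof F (⟨0, left_mem_Icc.2 hT⟩ : Icc 0 T) x
      (B * τ) 0 B (B * L) := by
    refine ⟨fun t ht => ?_, fun y _ => ?_, fun t ht y _ => ?_, ?_⟩
    · refine LipschitzOnWith.of_dist_le_mul fun y _ y' _ => ?_
      refine (dist_pi_le_iff (by positivity)).2 fun i => ?_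
      have hS : dist (S t y) (S t y') ≤ dist y y' := by
        refine (dist_pi_le_iff dist_nonneg).2 fun j => ?_
        rw [dist_smul₀]
        refine (mul_le_of_le_one_left dist_nonneg ?_).trans (dist_le_pi_dist y y' j)
        rw [Real.norm_of_nonneg (Real.exp_pos _).le, Real.exp_le_one_iff, neg_nonpos]
        exact mul_nonneg (hk j).le ht.1
      rw [dist_smul₀, NNReal.coe_mul, hB, mul_assoc]
      refine mul_le_mul (hgain t ht i) ?_ dist_nonneg hb0
      exact (dist_le_pi_dist _ _ i).trans ((hC.dist_le_mul _ _).trans (by gcongr))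
    · have h1 : Continuous fun t => S t y := by fun_prop
      have h2 := hC.continuous.comp h1
      have h3 : ∀ i, Continuous fun t => k i * Real.exp (k i * t) := fun i => by fun_prop
      exact (continuous_pi fun i => (h3 i).smul ((continuous_apply i).comp h2)).continuousOn
    · rw [hB]
      refine (pi_norm_le_iff_of_nonneg hb0).2 fun i => ?_
      rw [norm_smul]
      exact (mul_le_mul (hgain t ht i) (norm_le_one_of_mem_disk (hCd _ _)) (norm_nonneg _)
        hb0).trans_eq (mul_one b)
    · simp [hB, hτ, hT]
  obtain ⟨y, hy0, hy⟩ := hF.exists_eq_forall_mem_Icc_hasDerivWithinAt₀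
  have hy0' : y 0 = x := hy0
  have hyi : ∀ t ∈ Icc 0 T, ∀ i, HasDerivWithinAt (fun s => y s i) (F t (y t) i) (Icc 0 T) t :=
    fun t ht => hasDerivWithinAt_pi.1 (hy t ht)
  refine ⟨fun t => S t (y t), ?_, fun t ht => ⟨?_, ?_⟩⟩
  · funext i
    simp [S, hy0']
  · rw [mem_diskConfigs]
    intro i
    -- The targets have norm at most `1`, so the speed of `y i` is at most the derivative of `exp (k
    -- i * t)`. Undoing the substitution, this says that the disk is invariant.
    have hbound : ‖y t i‖ ≤ Real.exp (k i * t) := by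
      refine image_norm_le_of_norm_deriv_right_le_deriv_boundary (f := fun s => y s i)
        (f' := fun s => F s (y s) i) (B := fun s => Real.exp (k i * s))
        (B' := fun s => k i * Real.exp (k i * s))
        (fun s hs => (hyi s hs i).continuousWithinAt)
        (fun s hs => (hyi s (Ico_subset_Icc_self hs) i).mono_of_mem_nhdsWithin
          (Icc_mem_nhdsGE_of_mem hs)) ?_ ?_ ?_ ht
      · simpa [hy0'] using norm_le_one_of_mem_disk (mem_diskConfigs.1 hx i)
      · intro s
        simpa [mul_comm] using ((hasDerivAt_id s).const_mul (k i)).exp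
      · intro s hs
        have h1 : 0 ≤ k i * Real.exp (k i * s) := mul_nonneg (hk i).le (Real.exp_pos _).le
        rw [norm_smul, Real.norm_of_nonneg h1]
        exact mul_le_of_le_one_right h1 (norm_le_one_of_mem_disk (hCd _ _))
    rw [mem_disk_iff, norm_smul, Real.norm_of_nonneg (Real.exp_pos _).le, Real.exp_neg,
      inv_mul_le_iff₀ (Real.exp_pos _), mul_one]
    exact hbound
  · refine hasDerivWithinAt_pi.2 fun i => ?_
    have h1 : HasDerivAt (fun s => Real.exp (-(k i * s))) (Real.exp (-(k i * t)) * -(k i)) t := by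
      simpa using ((hasDerivAt_id t).const_mul (k i)).neg.exp
    refine (h1.hasDerivWithinAt.smul (hyi t ht i)).congr_deriv ?_
    have h2 : Real.exp (-(k i * t)) * (k i * Real.exp (k i * t)) = k i := by
      rw [mul_left_comm, ← Real.exp_add, neg_add_cancel, Real.exp_zero, mul_one]
    simp only [F, S]
    rw [smul_smul, h2]
    module

theorem exists_isPlanarSolution_Icc (hρ : IsDensity ρ) (hk : ∀ i, 0 < k i) {x : Fin n → E2}
    (hx : x ∈ diskConfigs n) (hi : Function.Injective x) {T : ℝ} (hT : 0 ≤ T) :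
    ∃ z : ℝ → Fin n → E2, z 0 = x ∧ IsPlanarSolution ρ k z (Icc 0 T) := by
  obtain ⟨δ₀, hδ₀, hx₀, -⟩ := exists_separated_mem_nhdsWithin hx hi
  -- Half of the separation that true solutions keep up to time `T`. The factor makes the
  -- contradiction at the first bad time strict.
  set δ := Real.exp (-(∑ l, k l) * T) * δ₀ / 2 with hδ
  have hδ0 : 0 < δ := by positivity
  obtain ⟨L, hL, hC⟩ := exists_lipschitz_cellCenter (n := n) hρ hδ0
  have hlip : LipschitzOnWith ⟨L, hL⟩ (cellCenter ρ) (separated n δ) :=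
    LipschitzOnWith.of_dist_le_mul fun z hz z' hz' => by
      refine (dist_pi_le_iff (by positivity)).2 fun i => ?_
      rw [dist_eq_norm, dist_eq_norm]
      exact hC z hz z' hz' i
  obtain ⟨G, hG, hGeq⟩ := hlip.extend_finite_dimension
  -- The Lipschitz extension may leave the disk; projecting brings its values back and changes
  -- nothing on the separated set, where the centers already lie in the disk.
  have hG' : LipschitzWith (1 * (lipschitzExtensionConstant (Fin n → E2) * ⟨L, hL⟩))
      (fun z i => diskProj (G z i)) := by
    refine LipschitzWith.of_dist_le_mul fun z z' => (dist_pi_le_iff (by positivity)).2 fun i => ?_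
    refine (lipschitzWith_diskProj.dist_le_mul _ _).trans ?_
    rw [NNReal.coe_mul 1, mul_assoc]
    gcongr
    exact (dist_le_pi_dist _ _ i).trans (hG.dist_le_mul _ _)
  obtain ⟨z, hz0, hz⟩ := exists_solution_of_lipschitz hk hG' (fun z i => diskProj_mem _) hx hT
  have hfield : ∀ t ∈ Icc 0 T, z t ∈ separated n δ →
      HasDerivWithinAt z (planarField ρ k (z t)) (Icc 0 T) t := by
    intro t ht hs
    convert! (hz t ht).2 using 1
    funext i
    rw [planarField, ← hGeq hs, diskProj_of_mem (cellCenter_mem_disk hρ (hs.1 i))]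
  have hcont : ContinuousOn z (Icc 0 T) := fun t ht => (hz t ht).2.continuousWithinAt
  have hsep : ∀ t ∈ Icc 0 T, ∀ i j, i ≠ j → δ < ‖z t i - z t j‖ := by
    by_contra! hbad
    set bad := {t | t ∈ Icc 0 T ∧ ∃ i j, i ≠ j ∧ ‖z t i - z t j‖ ≤ δ} with hbadset
    have hcompact : IsCompact bad := by
      have e : bad = ⋃ i, ⋃ j, {t | t ∈ Icc 0 T ∧ (i ≠ j ∧ ‖z t i - z t j‖ ≤ δ)} := by
        ext t
        simp [bad]
      rw [e]
      refine isCompact_iUnion fun i => isCompact_iUnion fun j => ?_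
      refine isCompact_Icc.of_isClosed_subset ?_ fun t ht => ht.1
      by_cases hij : i = j
      · simp [hij]
      · have h1 : ContinuousOn (fun t => ‖z t i - z t j‖) (Icc 0 T) :=
          ((continuousOn_pi.1 hcont i).sub (continuousOn_pi.1 hcont j)).norm
        have h2 := h1.preimage_isClosed_of_isClosed isClosed_Icc (isClosed_Iic (a := δ))
        convert! h2 using 1
        ext t
        simp [hij]
    obtain ⟨t, ⟨ht, i, j, hij, hle⟩, hmin⟩ := hcompact.exists_isLeast (by
      obtain ⟨t, ht, i, j, hij, h⟩ := hbad
      exact ⟨t, ht, i, j, hij, h⟩)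
    -- Before the first bad time the modified field is the true one. The exponential estimate needs
    -- the equation only on the open interval, and by continuity gives separation at least `2 * δ`
    -- at that time.
    have hbefore : ∀ s ∈ Ioo 0 t, z s ∈ separated n δ := by
      intro s hs
      have hsT : s ∈ Icc 0 T := ⟨hs.1.le, hs.2.le.trans ht.2⟩
      refine ⟨mem_diskConfigs.1 (hz s hsT).1, fun i' j' hij' => ?_⟩
      by_contra! hlt
      exact absurd (hmin ⟨hsT, i', j', hij', hlt.le⟩) (not_le.2 hs.2)
    have hst : Ioo 0 t ⊆ Icc 0 T := fun s hs => ⟨hs.1.le, hs.2.le.trans ht.2⟩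
    have h1 := exp_mul_norm_sub_le hρ hk ht.1 (hcont.mono (Icc_subset_Icc_right ht.2))
      (fun s hs => (hz s (hst hs)).1)
      (fun s hs => (hfield s (hst hs) (hbefore s hs)).hasDerivAt
        (Icc_mem_nhds hs.1 (hs.2.trans_le ht.2))) i j
    have h2 : Real.exp (-(∑ l, k l) * T) * δ₀ ≤
        Real.exp (-(∑ l, k l) * t) * ‖z 0 i - z 0 j‖ := by
      rw [hz0]
      exact mul_le_mul (exp_neg_mul_anti hk ht.2) (hx₀.2 i j hij) hδ₀.le (Real.exp_pos _).le
    linarith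
  refine ⟨z, hz0, fun t ht => (hz t ht).1, fun t ht => hfield t ht
    ⟨mem_diskConfigs.1 (hz t ht).1, fun i j hij => (hsep t ht i j hij).le⟩⟩

theorem exists_isPlanarSolution (hρ : IsDensity ρ) (hk : ∀ i, 0 < k i) {x : Fin n → E2}
    (hx : x ∈ diskConfigs n) (hi : Function.Injective x) :
    ∃ z : ℝ → Fin n → E2, z 0 = x ∧ IsPlanarSolution ρ k z (Ici 0) := by
  choose Z hZ0 hZ using fun m : ℕ => exists_isPlanarSolution_Icc hρ hk hx hi (Nat.cast_nonneg m)
  have hagree : ∀ m m' : ℕ, m ≤ m' → ∀ t ∈ Icc (0 : ℝ) m, Z m t = Z m' t := by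
    intro m m' h
    exact (hZ m).eqOn hρ hk (Nat.cast_nonneg m)
      ((hZ m').mono (Icc_subset_Icc_right (Nat.cast_le.2 h))) (by rw [hZ0, hZ0])
      (by rw [hZ0]; exact hi)
  have hceil : ∀ t : ℝ, 0 ≤ t → t ∈ Icc (0 : ℝ) ⌈t⌉₊ := fun t ht => ⟨ht, Nat.le_ceil t⟩
  have heq : ∀ m : ℕ, ∀ t ∈ Icc (0 : ℝ) m, Z ⌈t⌉₊ t = Z m t := fun m t ht =>
    hagree _ _ (Nat.ceil_le.2 ht.2) t (hceil t ht.1)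
  refine ⟨fun t => Z ⌈t⌉₊ t, by simp [hZ0], fun t ht => (hZ _).mem t (hceil t ht), ?_⟩
  intro t ht
  -- One unit beyond the ceiling, because for integer `t` the interval `[0, ⌈t⌉]` is not a
  -- neighborhood of `t` in `[0, ∞)`.
  have htm : t < ((⌈t⌉₊ + 1 : ℕ) : ℝ) := by
    push_cast
    linarith [Nat.le_ceil t]
  have htm' : t ∈ Icc (0 : ℝ) ((⌈t⌉₊ + 1 : ℕ) : ℝ) := ⟨ht, htm.le⟩
  have hnhds : Icc (0 : ℝ) ((⌈t⌉₊ + 1 : ℕ) : ℝ) ∈ 𝓝[Ici 0] t := by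
    rw [← Ici_inter_Iic]
    exact inter_mem_nhdsWithin _ (Iic_mem_nhds htm)
  have h1 := ((hZ (⌈t⌉₊ + 1)).hasDeriv t htm').mono_of_mem_nhdsWithin hnhds
  simp only [heq _ t htm']
  exact h1.congr_of_eventuallyEq (by filter_upwards [hnhds] with s hs using heq _ s hs)
    (heq _ t htm')

end

/-! ### The cost as a Lyapunov function and convergence -/

section

variable {n : ℕ} {ρ : E2 → ℝ} {k : Fin n → ℝ}

theorem mem_planarCentroidal_iff_costDeriv (hρ : IsDensity ρ) {z : Fin n → E2}
    (hz : z ∈ diskConfigs n) (hi : Function.Injective z) :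
    z ∈ planarCentroidal ρ n ↔ costDeriv ρ z = 0 := by
  constructor
  · intro h
    ext y
    simp [costDeriv_apply, cellGrad, ← h.2.2]
  · intro h
    refine ⟨hz, hi, fun i => ?_⟩
    classical
    have h1 : costDeriv ρ z (Pi.single i (cellGrad ρ z i)) = 0 := by simp [h]
    rw [costDeriv_apply, Finset.sum_eq_single i (fun j _ hj => by simp [hj]) (by simp),
      Pi.single_eq_same] at h1
    have h2 : cellGrad ρ z i = 0 := by simpa using h1
    rw [cellGrad, smul_eq_zero, sub_eq_zero] at h2
    exact h2.resolve_left (cellMass_pos hρ (mem_diskConfigs.1 hz i)).ne'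

theorem planarCost_nonneg (hρ : IsDensity ρ) (z : Fin n → E2) : 0 ≤ planarCost ρ z :=
  setIntegral_nonneg measurableSet_disk fun w hw =>
    mul_nonneg (Real.iInf_nonneg fun _ => sq_nonneg _) (hρ.pos w hw).le

theorem costDeriv_planarField (z : Fin n → E2) :
    costDeriv ρ z (planarField ρ k z) = -decayRate ρ k z := by
  rw [costDeriv_apply, decayRate, ← Finset.sum_neg_distrib]
  refine Finset.sum_congr rfl fun i _ => ?_
  rw [cellGrad, planarField, real_inner_smul_left, real_inner_smul_right,
    real_inner_self_eq_norm_sq]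
  ring

theorem norm_planarField_le (hρ : IsDensity ρ) (hk : ∀ i, 0 < k i) {z : Fin n → E2}
    (hz : z ∈ diskConfigs n) : ‖planarField ρ k z‖ ≤ (∑ l, k l) * 2 := by
  refine (pi_norm_le_iff_of_nonneg (mul_nonneg (sum_gain_nonneg hk) zero_le_two)).2 fun i => ?_
  have hd := mem_diskConfigs.1 hz i
  rw [planarField, norm_smul, norm_neg, Real.norm_of_nonneg (hk i).le]
  exact mul_le_mul (Finset.single_le_sum (fun l _ => (hk l).le) (Finset.mem_univ i))
    (norm_sub_le_two hd (cellCenter_mem_disk hρ hd)) (norm_nonneg _) (sum_gain_nonneg hk)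

namespace IsPlanarSolution

variable {z : ℝ → Fin n → E2}

theorem injective_of_Ici (hρ : IsDensity ρ) (hk : ∀ i, 0 < k i)
    (h : IsPlanarSolution ρ k z (Ici 0)) (hi : Function.Injective (z 0)) {t : ℝ} (ht : 0 ≤ t) :
    Function.Injective (z t) :=
  (h.mono (Icc_subset_Ici_self : Icc 0 t ⊆ Ici 0)).injective hρ hk hi (right_mem_Icc.2 ht)

theorem eqOn_Ici (hρ : IsDensity ρ) (hk : ∀ i, 0 < k i) {z' : ℝ → Fin n → E2}
    (h : IsPlanarSolution ρ k z (Ici 0)) (h' : IsPlanarSolution ρ k z' (Ici 0))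
    (h0 : z 0 = z' 0) (hi : Function.Injective (z 0)) : EqOn z z' (Ici 0) := fun _ ht =>
  (h.mono Icc_subset_Ici_self).eqOn hρ hk ht (h'.mono Icc_subset_Ici_self) h0 hi
    (right_mem_Icc.2 ht)

theorem hasDerivWithinAt_planarCost (hρ : IsDensity ρ) (hk : ∀ i, 0 < k i)
    (h : IsPlanarSolution ρ k z (Ici 0)) (hi : Function.Injective (z 0)) {t : ℝ} (ht : 0 ≤ t) :
    HasDerivWithinAt (fun s => planarCost ρ (z s)) (-decayRate ρ k (z t)) (Ici 0) t := by
  rw [← costDeriv_planarField]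
  exact (hasFDerivWithinAt_planarCost hρ (h.mem t ht)
    (h.injective_of_Ici hρ hk hi ht)).comp_hasDerivWithinAt t (h.hasDeriv t ht) h.mem

theorem planarCost_add_mul_le (hρ : IsDensity ρ) (hk : ∀ i, 0 < k i)
    (h : IsPlanarSolution ρ k z (Ici 0)) (hi : Function.Injective (z 0)) {s t η : ℝ} (hs : 0 ≤ s)
    (hst : s ≤ t) (hη : ∀ u ∈ Icc s t, η ≤ decayRate ρ k (z u)) :
    planarCost ρ (z t) + η * t ≤ planarCost ρ (z s) + η * s := by
  have hsub : Icc s t ⊆ Ici 0 := fun u hu => hs.trans hu.1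
  have hd : ∀ u ∈ Icc s t, HasDerivWithinAt (fun u => planarCost ρ (z u) + η * u)
      (-decayRate ρ k (z u) + η) (Icc s t) u := fun u hu =>
    ((h.hasDerivWithinAt_planarCost hρ hk hi (hsub hu)).mono hsub).add
      (((hasDerivAt_id u).const_mul η).hasDerivWithinAt.congr_deriv (mul_one η))
  exact antitoneOn_of_hasDerivWithinAt_nonpos (convex_Icc s t)
    (fun u hu => (hd u hu).continuousWithinAt)
    (fun u hu => (hd u (interior_subset hu)).mono interior_subset)
    (fun u hu => by linarith [hη u (interior_subset hu)])
    (left_mem_Icc.2 hst) (right_mem_Icc.2 hst) hst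

theorem planarCost_le (hρ : IsDensity ρ) (hk : ∀ i, 0 < k i)
    (h : IsPlanarSolution ρ k z (Ici 0)) (hi : Function.Injective (z 0)) {s t : ℝ} (hs : 0 ≤ s)
    (hst : s ≤ t) : planarCost ρ (z t) ≤ planarCost ρ (z s) := by
  have := h.planarCost_add_mul_le hρ hk hi hs hst (η := 0) fun u hu =>
    decayRate_nonneg hρ hk (h.mem u (hs.trans hu.1))
  simpa using this

/-- Equal costs at `s` and `t` would force a constant cost in between, by monotonicity. The
one-sided derivative at `s`, hence the decay rate there, would vanish. -/
theorem planarCost_lt (hρ : IsDensity ρ) (hk : ∀ i, 0 < k i)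
    (h : IsPlanarSolution ρ k z (Ici 0)) (hi : Function.Injective (z 0)) {s t : ℝ} (hs : 0 ≤ s)
    (hst : s < t) (hc : z s ∉ planarCentroidal ρ n) :
    planarCost ρ (z t) < planarCost ρ (z s) := by
  refine (h.planarCost_le hρ hk hi hs hst.le).lt_of_ne fun heq => hc ?_
  have hz := h.mem s hs
  refine ⟨hz, h.injective_of_Ici hρ hk hi hs, (decayRate_eq_zero_iff hρ hk hz).1 ?_⟩
  have hsub : Icc s t ⊆ Ici 0 := fun u hu => hs.trans hu.1
  have h1 := (h.hasDerivWithinAt_planarCost hρ hk hi hs).mono hsub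
  have h2 : HasDerivWithinAt (fun u => planarCost ρ (z u)) 0 (Icc s t) s := by
    refine (hasDerivWithinAt_const s (Icc s t) (planarCost ρ (z s))).congr (fun u hu => ?_) rfl
    exact le_antisymm (h.planarCost_le hρ hk hi hs hu.1)
      (heq ▸ h.planarCost_le hρ hk hi (hs.trans hu.1) hu.2)
  have h3 := (uniqueDiffOn_Icc hst s (left_mem_Icc.2 hst.le)).eq_deriv _ h1 h2
  linarith

theorem norm_sub_le (hρ : IsDensity ρ) (hk : ∀ i, 0 < k i)
    (h : IsPlanarSolution ρ k z (Ici 0)) {s t : ℝ} (hs : 0 ≤ s) (ht : 0 ≤ t) :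
    ‖z t - z s‖ ≤ (∑ l, k l) * 2 * |t - s| :=
  (convex_Ici 0).norm_image_sub_le_of_norm_hasDerivWithin_le h.hasDeriv
    (fun u hu => norm_planarField_le hρ hk (h.mem u hu)) hs ht

/-- Solutions of distinct points converge to the set of centroidal Voronoi configurations. -/
theorem tendsto_nhdsSet (hρ : IsDensity ρ) (hk : ∀ i, 0 < k i)
    (h : IsPlanarSolution ρ k z (Ici 0)) (hi : Function.Injective (z 0)) :
    Tendsto z atTop (𝓝ˢ (planarCentroidal ρ n)) := by
  refine (hasBasis_nhdsSet _).tendsto_right_iff.2 ?_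
  rintro U ⟨hU, hKU⟩
  obtain ⟨ε, hε, hεU⟩ := (isCompact_planarCentroidal hρ).exists_thickening_subset_open hU hKU
  obtain ⟨η, hη, hdecay⟩ := exists_le_decayRate hρ hk (Metric.isOpen_thickening (δ := ε / 2))
    (Metric.self_subset_thickening (half_pos hε) (planarCentroidal ρ n))
  set V := (∑ l, k l) * 2 + 1 with hV
  have hV0 : 0 < V := by linarith [sum_gain_nonneg hk]
  -- A time in which no trajectory moves farther than `ε / 2`. The summand `1` in `V` only keeps it
  -- positive.
  set τ := ε / 2 / V with hτ
  have hτ0 : 0 < τ := by positivity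
  set I := sInf ((fun t => planarCost ρ (z t)) '' Ici 0) with hI
  have hbdd : BddBelow ((fun t => planarCost ρ (z t)) '' Ici 0) :=
    ⟨0, by rintro _ ⟨t, -, rfl⟩; exact planarCost_nonneg hρ _⟩
  -- After `T` less than `η * τ` of cost remains to be lost, while a point outside `U` at time `t`
  -- would cost at least that much during `[t - τ, t]`.
  obtain ⟨_, ⟨T, hT, rfl⟩, hTI⟩ := exists_lt_of_csInf_lt
    (⟨_, mem_image_of_mem _ self_mem_Ici⟩ : ((fun t => planarCost ρ (z t)) '' Ici 0).Nonempty)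
    (lt_add_of_pos_right I (mul_pos hη hτ0))
  filter_upwards [eventually_ge_atTop (T + τ)] with t ht
  have hT0 : 0 ≤ T := hT
  have ht0 : 0 ≤ t - τ := by linarith
  by_contra hzt
  have hfar : ∀ u ∈ Icc (t - τ) t, η ≤ decayRate ρ k (z u) := by
    intro u hu
    have hu0 : 0 ≤ u := ht0.trans hu.1
    refine hdecay (z u) ⟨h.mem u hu0, fun hmem => hzt (hεU ?_)⟩
      (h.injective_of_Ici hρ hk hi hu0)
    obtain ⟨x, hx, hxd⟩ := Metric.mem_thickening_iff.1 hmem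
    refine Metric.mem_thickening_iff.2 ⟨x, hx, ?_⟩
    have h1 : dist (z t) (z u) ≤ ε / 2 := by
      rw [dist_eq_norm]
      refine (h.norm_sub_le hρ hk hu0 (by linarith)).trans ?_
      have h2 : |t - u| ≤ τ := by rw [abs_of_nonneg (by linarith [hu.2])]; linarith [hu.1]
      calc (∑ l, k l) * 2 * |t - u| ≤ V * τ :=
            mul_le_mul (by linarith) h2 (abs_nonneg _) hV0.le
        _ = ε / 2 := by rw [hτ, mul_div_cancel₀ _ hV0.ne']
    linarith [dist_triangle (z t) (z u) x]
  have h1 := h.planarCost_add_mul_le hρ hk hi ht0 (by linarith) hfar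
  have h2 := h.planarCost_le hρ hk hi hT0 (by linarith : T ≤ t - τ)
  have h3 : I ≤ planarCost ρ (z t) := csInf_le hbdd ⟨t, by simp only [mem_Ici]; linarith, rfl⟩
  linarith

/-- The difference is continuous, within the configurations in the disk, at each centroidal
configuration and vanishes there. -/
theorem tendsto_sub_cellCenter (hρ : IsDensity ρ) (hk : ∀ i, 0 < k i)
    (h : IsPlanarSolution ρ k z (Ici 0)) (hi : Function.Injective (z 0)) (i : Fin n) :
    Tendsto (fun t => z t i - cellCenter ρ (z t) i) atTop (𝓝 0) := by
  have h1 : Tendsto z atTop (𝓝ˢ (planarCentroidal ρ n) ⊓ 𝓟 (diskConfigs n)) :=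
    tendsto_inf.2 ⟨h.tendsto_nhdsSet hρ hk hi, tendsto_principal.2
      ((eventually_ge_atTop 0).mono fun t ht => h.mem t ht)⟩
  refine Tendsto.comp (g := fun y : Fin n → E2 => y i - cellCenter ρ y i) ?_ h1
  intro W hW
  rw [mem_map, mem_inf_principal, mem_nhdsSet_iff_forall]
  intro y hy
  have h2 : ContinuousWithinAt (fun y : Fin n → E2 => y i - cellCenter ρ y i) (diskConfigs n) y :=
    (continuous_apply i).continuousWithinAt.sub
      (continuousWithinAt_cellCenter hρ hy.1 hy.2.1 i)
  have h3 : W ∈ 𝓝 (y i - cellCenter ρ y i) := by rwa [← hy.2.2 i, sub_self]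
  exact mem_nhdsWithin_iff_eventually.1 (h2 h3)

end IsPlanarSolution

end

/-! ### Derivative of the inverse map and the transported density -/

section

theorem uniqueDiffOn_disk : UniqueDiffOn ℝ disk :=
  uniqueDiffOn_convex convex_disk (by
    rw [disk, interior_closedBall _ one_ne_zero]
    exact ⟨0, by simp⟩)

namespace IsConformalDiffeo

variable {f : E3 → E2} {Q : Set E3}

theorem inverseMap_mem (hf : IsConformalDiffeo f Q) {w : E2} (hw : w ∈ disk) :
    inverseMap f Q w ∈ Q := Function.invFunOn_mem (hf.bijOn.surjOn hw)

theorem apply_inverseMap (hf : IsConformalDiffeo f Q) {w : E2} (hw : w ∈ disk) :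
    f (inverseMap f Q w) = w := Function.invFunOn_eq (hf.bijOn.surjOn hw)

theorem inverseMap_apply (hf : IsConformalDiffeo f Q) {q : E3} (hq : q ∈ Q) :
    inverseMap f Q (f q) = q :=
  hf.bijOn.injOn (hf.inverseMap_mem (hf.bijOn.mapsTo hq)) hq
    (hf.apply_inverseMap (hf.bijOn.mapsTo hq))

theorem image_inverseMap_disk (hf : IsConformalDiffeo f Q) : inverseMap f Q '' disk = Q := by
  refine Subset.antisymm (image_subset_iff.2 fun w hw => hf.inverseMap_mem hw) fun q hq =>
    ⟨f q, hf.bijOn.mapsTo hq, hf.inverseMap_apply hq⟩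

theorem hasFDerivWithinAt (hf : IsConformalDiffeo f Q) {q : E3} (hq : q ∈ Q) :
    HasFDerivWithinAt f (fderivWithin ℝ f Q q) Q q :=
  (hf.contDiffOn.differentiableOn one_ne_zero q hq).hasFDerivWithinAt

theorem hasFDerivWithinAt_inverseMap (hf : IsConformalDiffeo f Q) {w : E2} (hw : w ∈ disk) :
    HasFDerivWithinAt (inverseMap f Q) (fderivWithin ℝ (inverseMap f Q) disk w) disk w :=
  (hf.contDiffOn_inverse.differentiableOn one_ne_zero w hw).hasFDerivWithinAt

theorem fderivWithin_apply_fderivWithin_inverseMap (hf : IsConformalDiffeo f Q) {w : E2}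
    (hw : w ∈ disk) (v : E2) :
    fderivWithin ℝ f Q (inverseMap f Q w) (fderivWithin ℝ (inverseMap f Q) disk w v) = v := by
  have h1 := (hf.hasFDerivWithinAt (hf.inverseMap_mem hw)).comp w
    (hf.hasFDerivWithinAt_inverseMap hw) (fun x hx => hf.inverseMap_mem hx)
  have h2 : HasFDerivWithinAt (f ∘ inverseMap f Q) (ContinuousLinearMap.id ℝ E2) disk w :=
    (hasFDerivWithinAt_id w disk).congr (fun x hx => hf.apply_inverseMap hx)
      (hf.apply_inverseMap hw)
  exact congrArg (fun L : E2 →L[ℝ] E2 => L v) ((uniqueDiffOn_disk w hw).eq h1 h2)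

/-- The derivative maps tangent directions of the disk to tangent directions of `Q`, and those of
the disk span the plane even at boundary points. -/
theorem fderivWithin_inverseMap_mem (hf : IsConformalDiffeo f Q) {w : E2} (hw : w ∈ disk)
    (v : E2) : fderivWithin ℝ (inverseMap f Q) disk w v ∈ tangentPlane Q (inverseMap f Q w) := by
  set G := fderivWithin ℝ (inverseMap f Q) disk w with hG
  have h1 : Submodule.span ℝ (tangentConeAt ℝ disk w) ≤
      (tangentPlane Q (inverseMap f Q w)).comap G.toLinearMap := by
    refine Submodule.span_le.2 fun u hu => ?_
    have h := (hf.hasFDerivWithinAt_inverseMap hw).mapsTo_tangent_cone hu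
    rw [hf.image_inverseMap_disk] at h
    exact Submodule.subset_span h
  have h2 : Submodule.span ℝ (tangentConeAt ℝ disk w) = ⊤ := by
    have h := Submodule.dense_iff_topologicalClosure_eq_top.1
      (uniqueDiffOn_disk w hw).dense_tangentConeAt
    rwa [(Submodule.closed_of_finiteDimensional _).submodule_topologicalClosure_eq] at h
  exact h1 (h2 ▸ Submodule.mem_top)

/-- The chain rule gives a right inverse of the Jacobian; conformality makes the Jacobian injective,
so it is a two-sided inverse. -/
theorem jacobian_inverse_apply (hf : IsConformalDiffeo f Q) {q : E3} (hq : q ∈ Q) (v : E2) :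
    (((jacobian f Q q).inverse v : tangentPlane Q q) : E3) =
      fderivWithin ℝ (inverseMap f Q) disk (f q) v := by
  have hw := hf.bijOn.mapsTo hq
  have hinv := hf.inverseMap_apply hq
  have hmem := hf.fderivWithin_inverseMap_mem hw
  have happ := hf.fderivWithin_apply_fderivWithin_inverseMap hw
  rw [hinv] at hmem happ
  set G := (fderivWithin ℝ (inverseMap f Q) disk (f q)).codRestrict (tangentPlane Q q) hmem with hG
  have h1 : (jacobian f Q q).comp G = ContinuousLinearMap.id ℝ E2 := by
    refine ContinuousLinearMap.ext fun u => ?_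
    exact happ u
  have hinj := (hf.conformal q hq).injective
  have h2 : G.comp (jacobian f Q q) = ContinuousLinearMap.id ℝ (tangentPlane Q q) := by
    refine ContinuousLinearMap.ext fun u => hinj ?_
    exact happ (jacobian f Q q u)
  rw [ContinuousLinearMap.inverse_eq h1 h2]
  rfl

/-- The conformal factor of the inverse map. -/
theorem exists_norm_fderivWithin_inverseMap (hf : IsConformalDiffeo f Q) {w : E2}
    (hw : w ∈ disk) : ∃ c : ℝ, 0 < c ∧
      ∀ v, ‖fderivWithin ℝ (inverseMap f Q) disk w v‖ = c * ‖v‖ := by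
  obtain ⟨c, hc, li, hli⟩ := hf.conformal _ (hf.inverseMap_mem hw)
  refine ⟨‖c‖⁻¹, by positivity, fun v => ?_⟩
  have h1 : jacobian f Q (inverseMap f Q w)
      ⟨fderivWithin ℝ (inverseMap f Q) disk w v, hf.fderivWithin_inverseMap_mem hw v⟩ = v :=
    hf.fderivWithin_apply_fderivWithin_inverseMap hw v
  rw [hli] at h1
  have h2 := congrArg norm h1
  simp only [_root_.smul_apply, norm_smul, LinearIsometry.coe_toContinuousLinearMap,
    LinearIsometry.norm_map, Submodule.coe_norm] at h2
  rw [← h2, inv_mul_cancel_left₀ (norm_ne_zero_iff.2 hc)]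

theorem norm_fderivWithin_inverseMap_pos (hf : IsConformalDiffeo f Q) {w : E2}
    (hw : w ∈ disk) : 0 < ‖fderivWithin ℝ (inverseMap f Q) disk w‖ := by
  obtain ⟨c, hc, h⟩ := hf.exists_norm_fderivWithin_inverseMap hw
  obtain ⟨v, hv⟩ := exists_ne (0 : E2)
  refine norm_pos_iff.2 fun h0 => ?_
  have h1 := h v
  rw [h0, _root_.zero_apply, norm_zero] at h1
  exact (mul_pos hc (norm_pos_iff.2 hv)).ne h1

theorem norm_fderivWithin_inverseMap_apply (hf : IsConformalDiffeo f Q) {w : E2}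
    (hw : w ∈ disk) (v : E2) : ‖fderivWithin ℝ (inverseMap f Q) disk w v‖ =
      ‖fderivWithin ℝ (inverseMap f Q) disk w‖ * ‖v‖ := by
  obtain ⟨c, hc, h⟩ := hf.exists_norm_fderivWithin_inverseMap hw
  rw [ContinuousLinearMap.homothety_norm _ h, h]

/-- The derivative is its norm times a linear isometry of the plane, so areas scale by the square of
the norm. -/
theorem normDet_fderivWithin_inverseMap (hf : IsConformalDiffeo f Q) {w : E2} (hw : w ∈ disk) :
    (fderivWithin ℝ (inverseMap f Q) disk w).toLinearMap.normDet =
      ‖fderivWithin ℝ (inverseMap f Q) disk w‖ ^ 2 := by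
  set G := fderivWithin ℝ (inverseMap f Q) disk w with hG
  have hpos : 0 < ‖G‖ := hf.norm_fderivWithin_inverseMap_pos hw
  let li : E2 →ₗᵢ[ℝ] E3 := ⟨‖G‖⁻¹ • G.toLinearMap, fun v => by
    change ‖‖G‖⁻¹ • G v‖ = ‖v‖
    rw [norm_smul, hf.norm_fderivWithin_inverseMap_apply hw, norm_inv, norm_norm,
      inv_mul_cancel_left₀ hpos.ne']⟩
  have h1 : G.toLinearMap = ‖G‖ • li.toLinearMap := by
    change G.toLinearMap = ‖G‖ • (‖G‖⁻¹ • G.toLinearMap)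
    rw [smul_smul, mul_inv_cancel₀ hpos.ne', one_smul]
  rw [h1, LinearMap.normDet_smul, li.normDet_eq_one, norm_norm, mul_one, finrank_euclideanSpace_fin]

theorem continuousOn_fderivWithin_inverseMap (hf : IsConformalDiffeo f Q) :
    ContinuousOn (fderivWithin ℝ (inverseMap f Q) disk) disk :=
  hf.contDiffOn_inverse.continuousOn_fderivWithin uniqueDiffOn_disk le_rfl

theorem isDensity_diskDensity (hf : IsConformalDiffeo f Q) {φ : E3 → ℝ} (hφc : ContinuousOn φ Q)
    (hφ : ∀ q ∈ Q, 0 < φ q) : IsDensity (diskDensity f Q φ) := by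
  refine ⟨?_, fun w hw => ?_⟩
  · refine ContinuousOn.mul (hφc.comp hf.contDiffOn_inverse.continuousOn
      fun w hw => hf.inverseMap_mem hw) ?_
    exact (hf.continuousOn_fderivWithin_inverseMap.norm.pow 2).congr
      fun w hw => hf.normDet_fderivWithin_inverseMap hw
  · rw [diskDensity, hf.normDet_fderivWithin_inverseMap hw]
    exact mul_pos (hφ _ (hf.inverseMap_mem hw)) (pow_pos (hf.norm_fderivWithin_inverseMap_pos hw) 2)

end IsConformalDiffeo

end

/-! ### Area formula for the conformal parametrization -/

section

theorem euclideanHausdorffMeasure_image_le {X Y : Type*} [MetricSpace X] [MeasurableSpace X]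
    [BorelSpace X] [MetricSpace Y] [MeasurableSpace Y] [BorelSpace Y] {g : X → Y} {A : Set X}
    {K : ℝ≥0} (hg : LipschitzOnWith K g A) (d : ℕ) :
    μHE[d] (g '' A) ≤ (K : ℝ≥0∞) ^ d * μHE[d] A := by
  simp only [Measure.euclideanHausdorffMeasure_def, Measure.smul_apply, ENNReal.smul_def,
    smul_eq_mul]
  rw [mul_left_comm]
  gcongr
  simpa using hg.hausdorffMeasure_image_le (d := d) (Nat.cast_nonneg d)

namespace IsConformalDiffeo

variable {f : E3 → E2} {Q : Set E3}

/-- Near each point of the disk the inverse map is up to a factor close to `1` a similarity. -/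
theorem exists_bilipschitz_nhdsWithin (hf : IsConformalDiffeo f Q) {x : E2} (hx : x ∈ disk)
    {c : ℝ} (hc : 1 < c) : ∃ l : ℝ, 0 < l ∧ ∃ U ∈ 𝓝[disk] x, U ⊆ disk ∧ MeasurableSet U ∧
      (∀ w ∈ U, l ≤ c * ‖fderivWithin ℝ (inverseMap f Q) disk w‖ ∧
        ‖fderivWithin ℝ (inverseMap f Q) disk w‖ ≤ c * l) ∧
      (∀ w ∈ U, ∀ w' ∈ U, ‖inverseMap f Q w - inverseMap f Q w'‖ ≤ c * l * ‖w - w'‖ ∧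
        l * ‖w - w'‖ ≤ c * ‖inverseMap f Q w - inverseMap f Q w'‖) := by
  set g := inverseMap f Q with hg
  set G := fderivWithin ℝ g disk with hG
  have hl : 0 < ‖G x‖ := hf.norm_fderivWithin_inverseMap_pos hx
  have hc0 : 0 < c := by linarith
  -- Makes `‖G x‖ - ε = ‖G x‖ / c`, and then also `‖G x‖ + ε ≤ c * ‖G x‖`.
  set ε := (1 - c⁻¹) * ‖G x‖ with hε
  have hcinv : c⁻¹ < 1 := inv_lt_one_of_one_lt₀ hc
  have hε0 : 0 < ε := mul_pos (by linarith) hl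
  have hcε : c * ε = (c - 1) * ‖G x‖ := by
    rw [hε]
    field_simp
  have hεle : ε ≤ (c - 1) * ‖G x‖ := by rw [← hcε]; nlinarith
  have hcont : ∀ᶠ w in 𝓝[disk] x, ‖G w - G x‖ < ε := by
    have := hf.continuousOn_fderivWithin_inverseMap x hx
    filter_upwards [this (Metric.ball_mem_nhds _ hε0)] with w hw
    simpa [dist_eq_norm] using hw
  obtain ⟨r, hr, hball⟩ := Metric.mem_nhdsWithin_iff.1 hcont
  refine ⟨‖G x‖, hl, Metric.ball x r ∩ disk, ?_, inter_subset_right,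
    Metric.isOpen_ball.measurableSet.inter measurableSet_disk, fun w hw => ?_,
    fun w hw w' hw' => ?_⟩
  · exact inter_mem (mem_nhdsWithin_of_mem_nhds (Metric.ball_mem_nhds x hr)) self_mem_nhdsWithin
  · have h1 : ‖G w - G x‖ < ε := hball hw
    have h2 := abs_le.1 ((abs_norm_sub_norm_le (G w) (G x)).trans h1.le)
    constructor
    · nlinarith
    · linarith
  · have h1 : ‖g w - g w' - G x (w - w')‖ ≤ ε * ‖w - w'‖ :=
      ((convex_ball x r).inter convex_disk).norm_image_sub_le_of_norm_hasFDerivWithin_le'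
        (fun y hy => (hf.hasFDerivWithinAt_inverseMap hy.2).mono inter_subset_right)
        (fun y hy => (show ‖G y - G x‖ < ε from hball hy).le) hw' hw
    have h2 := abs_le.1 ((abs_norm_sub_norm_le (g w - g w') (G x (w - w'))).trans h1)
    rw [hf.norm_fderivWithin_inverseMap_apply hx] at h2
    have h3 := norm_nonneg (w - w')
    have h4 : ε * ‖w - w'‖ ≤ (c - 1) * ‖G x‖ * ‖w - w'‖ := by gcongr
    have h5 : c * (ε * ‖w - w'‖) = (c - 1) * ‖G x‖ * ‖w - w'‖ := by rw [← mul_assoc, hcε]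
    constructor
    · linarith
    · nlinarith

/-- The area density of the inverse map. -/
def areaDensity (f : E3 → E2) (Q : Set E3) (w : E2) : ℝ≥0∞ :=
  ENNReal.ofReal (‖fderivWithin ℝ (inverseMap f Q) disk w‖ ^ 2)

/-- The inverse map has Lipschitz constant `c * l` and `f` has `c / l` on the image, which compares
Hausdorff measures in both directions. One factor `c ^ 2` comes from this and another from replacing
`l` by the norm of the derivative. -/
theorem exists_area_comparison (hf : IsConformalDiffeo f Q) {x : E2} (hx : x ∈ disk)
    {c : ℝ} (hc : 1 < c) : ∃ U ∈ 𝓝[disk] x, U ⊆ disk ∧ MeasurableSet U ∧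
      ∀ A ⊆ U, MeasurableSet A →
        μHE[2] (inverseMap f Q '' A) ≤ ENNReal.ofReal (c ^ 4) * ∫⁻ w in A, areaDensity f Q w ∧
        ∫⁻ w in A, areaDensity f Q w ≤ ENNReal.ofReal (c ^ 4) * μHE[2] (inverseMap f Q '' A) := by
  obtain ⟨l, hl, U, hU, hUd, hUm, hder, hlip⟩ := hf.exists_bilipschitz_nhdsWithin hx hc
  have hc0 : 0 < c := by linarith
  refine ⟨U, hU, hUd, hUm, fun A hAU hA => ⟨?_, ?_⟩⟩
  · have h1 : LipschitzOnWith (c * l).toNNReal (inverseMap f Q) A :=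
      LipschitzOnWith.of_dist_le_mul fun w hw w' hw' => by
        rw [Real.coe_toNNReal _ (by positivity), dist_eq_norm, dist_eq_norm]
        exact (hlip w (hAU hw) w' (hAU hw')).1
    refine (euclideanHausdorffMeasure_image_le h1 2).trans ?_
    rw [EuclideanSpace.euclideanHausdorffMeasure_eq_volume, ← setLIntegral_const,
      ← lintegral_const_mul' _ _ ENNReal.ofReal_ne_top]
    refine setLIntegral_mono' hA fun w hw => ?_
    change ENNReal.ofReal (c * l) ^ 2 ≤ _
    rw [← ENNReal.ofReal_pow (by positivity), areaDensity, ← ENNReal.ofReal_mul (by positivity)]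
    apply ENNReal.ofReal_le_ofReal
    calc (c * l) ^ 2 ≤ (c * (c * ‖fderivWithin ℝ (inverseMap f Q) disk w‖)) ^ 2 := by
          gcongr
          exact (hder w (hAU hw)).1
      _ = _ := by ring
  · have h1 : LipschitzOnWith (c / l).toNNReal f (inverseMap f Q '' A) := by
      refine LipschitzOnWith.of_dist_le_mul ?_
      rintro _ ⟨w, hw, rfl⟩ _ ⟨w', hw', rfl⟩
      rw [Real.coe_toNNReal _ (by positivity), dist_eq_norm, dist_eq_norm,
        hf.apply_inverseMap (hUd (hAU hw)), hf.apply_inverseMap (hUd (hAU hw')),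
        div_mul_eq_mul_div, le_div_iff₀ hl, mul_comm]
      exact (hlip w (hAU hw) w' (hAU hw')).2
    have h2 := euclideanHausdorffMeasure_image_le h1 2
    have h3 : f '' (inverseMap f Q '' A) = A := by
      rw [image_image]
      exact (image_congr fun w hw => hf.apply_inverseMap (hUd (hAU hw))).trans (image_id' A)
    rw [h3, EuclideanSpace.euclideanHausdorffMeasure_eq_volume] at h2
    calc ∫⁻ w in A, areaDensity f Q w ≤ ∫⁻ _w in A, ENNReal.ofReal ((c * l) ^ 2) := by
          refine setLIntegral_mono' hA fun w hw => ENNReal.ofReal_le_ofReal ?_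
          gcongr
          exact (hder w (hAU hw)).2
      _ = ENNReal.ofReal ((c * l) ^ 2) * volume A := setLIntegral_const _ _
      _ ≤ ENNReal.ofReal ((c * l) ^ 2) *
          (((c / l).toNNReal : ℝ≥0∞) ^ 2 * μHE[2] (inverseMap f Q '' A)) := by gcongr
      _ = ENNReal.ofReal (c ^ 4) * μHE[2] (inverseMap f Q '' A) := by
          change _ * (ENNReal.ofReal (c / l) ^ 2 * _) = _
          rw [← ENNReal.ofReal_pow (by positivity), ← mul_assoc,
            ← ENNReal.ofReal_mul (by positivity)]
          congr 2
          field_simp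

theorem aemeasurable (hf : IsConformalDiffeo f Q) (hQ : IsCompact Q) (μ : Measure E3) :
    AEMeasurable f (μ.restrict Q) :=
  hf.contDiffOn.continuousOn.aemeasurable hQ.measurableSet

theorem map_apply (hf : IsConformalDiffeo f Q) (hQ : IsCompact Q) (μ : Measure E3) {A : Set E2}
    (hA : MeasurableSet A) (hAd : A ⊆ disk) :
    (μ.restrict Q).map f A = μ (inverseMap f Q '' A) := by
  have h : f ⁻¹' A ∩ Q = inverseMap f Q '' A := by
    ext q
    constructor
    · rintro ⟨h1, h2⟩
      exact ⟨f q, h1, hf.inverseMap_apply h2⟩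
    · rintro ⟨w, hw, rfl⟩
      exact ⟨by rwa [mem_preimage, hf.apply_inverseMap (hAd hw)], hf.inverseMap_mem (hAd hw)⟩
  rw [Measure.map_apply_of_aemeasurable (hf.aemeasurable hQ μ) hA,
    Measure.restrict_apply' hQ.measurableSet, h]

/-- The area formula: `f` transports the surface area of `Q` to the area density of its inverse. -/
theorem map_restrict_eq_withDensity (hf : IsConformalDiffeo f Q) (hQ : IsCompact Q) :
    ((μHE[2] : Measure E3).restrict Q).map f =
      (volume.restrict disk).withDensity (areaDensity f Q) := by
  set ν := ((μHE[2] : Measure E3).restrict Q).map f with hν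
  set τ := (volume.restrict disk).withDensity (areaDensity f Q) with hτ
  have hτA : ∀ A, MeasurableSet A → A ⊆ disk → τ A = ∫⁻ w in A, areaDensity f Q w := by
    intro A hA hAd
    rw [hτ, withDensity_apply _ hA, Measure.restrict_restrict hA, inter_eq_self_of_subset_left hAd]
  have hcompare : ∀ c : ℝ, 1 < c → ∀ A, MeasurableSet A → A ⊆ disk →
      ν A ≤ ENNReal.ofReal (c ^ 4) * τ A ∧ τ A ≤ ENNReal.ofReal (c ^ 4) * ν A := by
    intro c hc
    -- The local comparisons are patched by compactness. The measurable superset `S` is carried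
    -- along so that a test set can be split into the disjoint pieces `A ∩ S` and `A \ S`.
    have key : ∃ S, disk ⊆ S ∧ MeasurableSet S ∧ ∀ A ⊆ S, MeasurableSet A → A ⊆ disk →
        ν A ≤ ENNReal.ofReal (c ^ 4) * τ A ∧ τ A ≤ ENNReal.ofReal (c ^ 4) * ν A := by
      refine isCompact_disk.induction_on (p := fun R => ∃ S, R ⊆ S ∧ MeasurableSet S ∧
        ∀ A ⊆ S, MeasurableSet A → A ⊆ disk →
          ν A ≤ ENNReal.ofReal (c ^ 4) * τ A ∧ τ A ≤ ENNReal.ofReal (c ^ 4) * ν A)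
        ⟨∅, Subset.rfl, MeasurableSet.empty, fun A hA _ _ => by simp [subset_empty_iff.1 hA]⟩
        ?_ ?_ ?_
      · rintro R R' hRR ⟨S, hS, h⟩
        exact ⟨S, hRR.trans hS, h⟩
      · rintro R R' ⟨S, hS, hSm, h⟩ ⟨S', hS', hSm', h'⟩
        refine ⟨S ∪ S', union_subset_union hS hS', hSm.union hSm', fun A hA hAm hAd => ?_⟩
        have h1 := h (A ∩ S) inter_subset_right (hAm.inter hSm) (inter_subset_left.trans hAd)
        have h2 := h' (A \ S) (fun w hw => (hA hw.1).resolve_left hw.2) (hAm.diff hSm)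
          (sdiff_subset.trans hAd)
        rw [← measure_inter_add_sdiff (μ := ν) A hSm, ← measure_inter_add_sdiff (μ := τ) A hSm,
          mul_add, mul_add]
        exact ⟨add_le_add h1.1 h2.1, add_le_add h1.2 h2.2⟩
      · intro x hx
        obtain ⟨U, hU, hUd, hUm, h⟩ := hf.exists_area_comparison hx hc
        refine ⟨U, hU, U, Subset.rfl, hUm, fun A hA hAm hAd => ?_⟩
        rw [hτA A hAm hAd, hν, hf.map_apply hQ _ hAm hAd]
        exact h A hA hAm
    obtain ⟨S, hS, -, h⟩ := key
    exact fun A hA hAd => h A (hAd.trans hS) hA hAd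
  -- Letting `c` decrease to `1` turns the two-sided comparison into equality.
  have hle : ∀ a b : ℝ≥0∞, (∀ c : ℝ, 1 < c → a ≤ ENNReal.ofReal (c ^ 4) * b) → a ≤ b := by
    intro a b h
    have h1 : Tendsto (fun c : ℝ => ENNReal.ofReal (c ^ 4) * b) (𝓝[>] 1) (𝓝 (1 * b)) := by
      refine ENNReal.Tendsto.mul_const ?_ (Or.inl one_ne_zero)
      have : Continuous fun c : ℝ => ENNReal.ofReal (c ^ 4) :=
        ENNReal.continuous_ofReal.comp (by fun_prop)
      simpa using (this.tendsto 1).mono_left nhdsWithin_le_nhds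
    rw [one_mul] at h1
    exact ge_of_tendsto h1 (by filter_upwards [self_mem_nhdsWithin] with c hc using h c hc)
  have hdisk : ∀ A, MeasurableSet A → A ⊆ disk → ν A = τ A := fun A hA hAd =>
    le_antisymm (hle _ _ fun c hc => (hcompare c hc A hA hAd).1)
      (hle _ _ fun c hc => (hcompare c hc A hA hAd).2)
  have hνc : ν diskᶜ = 0 := by
    rw [hν, Measure.map_apply_of_aemeasurable (hf.aemeasurable hQ _) measurableSet_disk.compl,
      Measure.restrict_apply' hQ.measurableSet]
    have : f ⁻¹' diskᶜ ∩ Q = ∅ :=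
      eq_empty_of_forall_notMem fun q hq => hq.1 (hf.bijOn.mapsTo hq.2)
    rw [this, measure_empty]
  have hτc : τ diskᶜ = 0 := by
    refine withDensity_absolutelyContinuous _ _ ?_
    rw [Measure.restrict_apply' measurableSet_disk, compl_inter_self, measure_empty]
  refine Measure.ext fun A hA => ?_
  rw [← measure_inter_add_sdiff (μ := ν) A measurableSet_disk,
    ← measure_inter_add_sdiff (μ := τ) A measurableSet_disk,
    hdisk _ (hA.inter measurableSet_disk) inter_subset_right,
    measure_mono_null (s := A \ disk) (fun w hw => hw.2) hνc,
    measure_mono_null (s := A \ disk) (fun w hw => hw.2) hτc]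

theorem cost_eq_planarCost (hf : IsConformalDiffeo f Q) (hQ : IsCompact Q) {φ : E3 → ℝ}
    (hφc : ContinuousOn φ Q) {n : ℕ} (P : Fin n → E3) :
    cost f Q φ P = planarCost (diskDensity f Q φ) fun i => f (P i) := by
  set u : E2 → ℝ := fun w => (⨅ i, ‖w - f (P i)‖ ^ 2) * φ (inverseMap f Q w) with hu
  have hucont : ContinuousOn u disk :=
    (continuous_iInf_norm_sub_sq fun i => f (P i)).continuousOn.mul
      (hφc.comp hf.contDiffOn_inverse.continuousOn fun w hw => hf.inverseMap_mem hw)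
  have hmeas : AEMeasurable (areaDensity f Q) (volume.restrict disk) :=
    ((hf.continuousOn_fderivWithin_inverseMap.norm.pow 2).aemeasurable
      measurableSet_disk).ennreal_ofReal
  have h1 : cost f Q φ P = ∫ q in Q, u (f q) ∂(μHE[2] : Measure E3) :=
    setIntegral_congr_fun hQ.measurableSet fun q hq => by
      simp only [hu, hf.inverseMap_apply hq]
  have h2 : AEStronglyMeasurable u (((μHE[2] : Measure E3).restrict Q).map f) := by
    rw [hf.map_restrict_eq_withDensity hQ]
    exact (hucont.aestronglyMeasurable measurableSet_disk).mono_ac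
      (withDensity_absolutelyContinuous _ _)
  rw [h1, ← integral_map (hf.aemeasurable hQ _) h2, hf.map_restrict_eq_withDensity hQ,
    integral_withDensity_eq_integral_toReal_smul₀ hmeas
      (Eventually.of_forall fun w => ENNReal.ofReal_lt_top), planarCost]
  refine setIntegral_congr_fun measurableSet_disk fun w hw => ?_
  simp only [hu, areaDensity, diskDensity, hf.normDet_fderivWithin_inverseMap hw, smul_eq_mul,
    ENNReal.toReal_ofReal (sq_nonneg _)]
  ring

end IsConformalDiffeo

end

/-! ### Transfer between the surface and the disk -/

section

namespace IsConformalDiffeo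

variable {f : E3 → E2} {Q : Set E3} {φ : E3 → ℝ} {n : ℕ} {k : Fin n → ℝ}

theorem mem_diskConfigs_comp (hf : IsConformalDiffeo f Q) {P : Fin n → E3} (hP : ∀ i, P i ∈ Q) :
    (fun i => f (P i)) ∈ diskConfigs n := mem_diskConfigs.2 fun i => hf.bijOn.mapsTo (hP i)

theorem injective_comp_iff (hf : IsConformalDiffeo f Q) {P : Fin n → E3} (hP : ∀ i, P i ∈ Q) :
    (Function.Injective fun i => f (P i)) ↔ Function.Injective P :=
  ⟨fun h _ _ hij => h (congrArg f hij), fun h _ _ hij => h (hf.bijOn.injOn (hP _) (hP _) hij)⟩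

theorem mem_centroidalConfigs_iff (hf : IsConformalDiffeo f Q) {P : Fin n → E3}
    (hP : ∀ i, P i ∈ Q) : P ∈ centroidalConfigs f Q φ n ↔
      (fun i => f (P i)) ∈ planarCentroidal (diskDensity f Q φ) n :=
  ⟨fun h => ⟨hf.mem_diskConfigs_comp hP, (hf.injective_comp_iff hP).2 h.2.1, h.2.2⟩,
    fun h => ⟨hP, (hf.injective_comp_iff hP).1 h.2.1, h.2.2⟩⟩

theorem inverseMap_comp_mem_centroidalConfigs (hf : IsConformalDiffeo f Q) {z : Fin n → E2}
    (hz : z ∈ planarCentroidal (diskDensity f Q φ) n) :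
    (fun i => inverseMap f Q (z i)) ∈ centroidalConfigs f Q φ n := by
  have hd := mem_diskConfigs.1 hz.1
  refine (hf.mem_centroidalConfigs_iff fun i => hf.inverseMap_mem (hd i)).2 ?_
  simpa only [hf.apply_inverseMap (hd _)] using hz

theorem hasFDerivWithinAt_pi_comp {E F : Type*} [NormedAddCommGroup E] [NormedSpace ℝ E]
    [NormedAddCommGroup F] [NormedSpace ℝ F] {u : E → F} {s : Set E} {u' : E → E →L[ℝ] F}
    (hu : ∀ x ∈ s, HasFDerivWithinAt u (u' x) s x) {P : Fin n → E} (hP : ∀ i, P i ∈ s) :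
    HasFDerivWithinAt (fun (x : Fin n → E) i => u (x i))
      (ContinuousLinearMap.pi fun i => (u' (P i)).comp (ContinuousLinearMap.proj i))
      (Set.univ.pi fun _ => s) P :=
  hasFDerivWithinAt_pi.2 fun i => (hu (P i) (hP i)).comp P
    (hasFDerivAt_apply i P).hasFDerivWithinAt fun _ hR => hR i (mem_univ i)

/-- The distinct critical points of the cost are the centroidal Voronoi configurations. -/
theorem mem_centroidalConfigs_iff_hasFDerivWithinAt (hf : IsConformalDiffeo f Q)
    (hQ : IsCompact Q) (hφc : ContinuousOn φ Q) (hφ : ∀ q ∈ Q, 0 < φ q) {P : Fin n → E3}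
    (hP : ∀ i, P i ∈ Q) (hi : Function.Injective P) :
    P ∈ centroidalConfigs f Q φ n ↔
      HasFDerivWithinAt (cost f Q φ) (0 : (Fin n → E3) →L[ℝ] ℝ) (Set.univ.pi fun _ => Q) P := by
  have hρ := hf.isDensity_diskDensity hφc hφ
  have hz := hf.mem_diskConfigs_comp hP
  have hzi := (hf.injective_comp_iff hP).2 hi
  have hder := hasFDerivWithinAt_planarCost hρ hz hzi
  have hcost : cost f Q φ = fun R : Fin n → E3 =>
      planarCost (diskDensity f Q φ) fun i => f (R i) :=
    funext fun R => hf.cost_eq_planarCost hQ hφc R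
  rw [hf.mem_centroidalConfigs_iff hP, mem_planarCentroidal_iff_costDeriv hρ hz hzi]
  constructor
  · intro h
    rw [h] at hder
    rw [hcost]
    exact (hder.comp P (hasFDerivWithinAt_pi_comp (fun q hq => hf.hasFDerivWithinAt hq) hP)
      fun R hR => hf.mem_diskConfigs_comp fun i => hR i (mem_univ i)).congr_fderiv
        (ContinuousLinearMap.zero_comp _)
  · intro h
    have hinv : (fun i => inverseMap f Q (f (P i))) = P := funext fun i =>
      hf.inverseMap_apply (hP i)
    -- The vanishing derivative is pulled back to the disk, where derivatives within the product of
    -- disks are unique; uniqueness on the powers of `Q` in the ambient space is never needed.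
    have h1 := hasFDerivWithinAt_pi_comp (fun w hw => hf.hasFDerivWithinAt_inverseMap hw)
      fun i => hf.bijOn.mapsTo (hP i)
    rw [← hinv] at h
    have hmaps : MapsTo (fun (R : Fin n → E2) i => inverseMap f Q (R i)) (diskConfigs n)
        (Set.univ.pi fun _ => Q) := fun z hz i _ => hf.inverseMap_mem (mem_diskConfigs.1 hz i)
    have h2 := h.comp (fun i => f (P i)) h1 hmaps
    have h3 : ∀ z ∈ diskConfigs n, planarCost (diskDensity f Q φ) z =
        (cost f Q φ ∘ fun (R : Fin n → E2) i => inverseMap f Q (R i)) z := by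
      intro z hz
      simp only [hcost, Function.comp, hf.apply_inverseMap (mem_diskConfigs.1 hz _)]
    have h4 := (h2.congr h3 (h3 _ hz)).congr_fderiv (ContinuousLinearMap.zero_comp _)
    exact (UniqueDiffOn.univ_pi (fun _ => uniqueDiffOn_disk) _ hz).eq hder h4

theorem control_eq (hf : IsConformalDiffeo f Q) {P : Fin n → E3} (hP : ∀ i, P i ∈ Q) (i : Fin n) :
    control f Q φ k P i = fderivWithin ℝ (inverseMap f Q) disk (f (P i))
      (planarField (diskDensity f Q φ) k (fun i => f (P i)) i) := by
  rw [control, hf.jacobian_inverse_apply (hP i), planarField, map_smul]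
  rfl

theorem isPlanarSolution (hf : IsConformalDiffeo f Q) {P : ℝ → Fin n → E3}
    (h : IsTrajectory f Q φ k P) :
    IsPlanarSolution (diskDensity f Q φ) k (fun t i => f (P t i)) (Ici 0) := by
  refine ⟨fun t ht => hf.mem_diskConfigs_comp (h.mem t ht), fun t ht =>
    hasDerivWithinAt_pi.2 fun i => ?_⟩
  have hPt := h.mem t ht
  have h1 := (hf.hasFDerivWithinAt (hPt i)).comp_hasDerivWithinAt t (h.hasDeriv t ht i)
    fun s hs => h.mem s hs i
  refine h1.congr_deriv ?_
  have h2 := hf.fderivWithin_apply_fderivWithin_inverseMap (hf.bijOn.mapsTo (hPt i))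
  rw [hf.inverseMap_apply (hPt i)] at h2
  rw [hf.control_eq hPt, h2]

theorem isTrajectory (hf : IsConformalDiffeo f Q) {z : ℝ → Fin n → E2}
    (h : IsPlanarSolution (diskDensity f Q φ) k z (Ici 0)) :
    IsTrajectory f Q φ k fun t i => inverseMap f Q (z t i) := by
  have hd : ∀ t, 0 ≤ t → ∀ i, z t i ∈ disk := fun t ht => mem_diskConfigs.1 (h.mem t ht)
  have hmem : ∀ t, 0 ≤ t → ∀ i, inverseMap f Q (z t i) ∈ Q := fun t ht i =>
    hf.inverseMap_mem (hd t ht i)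
  refine ⟨hmem, fun t ht i => ?_⟩
  rw [hf.control_eq (hmem t ht)]
  simp only [hf.apply_inverseMap (hd t ht _)]
  exact (hf.hasFDerivWithinAt_inverseMap (hd t ht i)).comp_hasDerivWithinAt t
    (hasDerivWithinAt_pi.1 (h.hasDeriv t ht) i) fun s hs => hd s hs i

/-- A globally continuous extension of the inverse map, so that convergence to a set can be
transported by continuity on the whole space. -/
theorem continuous_inverseMap_diskProj (hf : IsConformalDiffeo f Q) :
    Continuous fun x => inverseMap f Q (diskProj x) :=
  hf.contDiffOn_inverse.continuousOn.comp_continuous lipschitzWith_diskProj.continuous diskProj_mem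

theorem tendsto_nhdsSet_centroidalConfigs (hf : IsConformalDiffeo f Q) {z : ℝ → Fin n → E2}
    (h : IsPlanarSolution (diskDensity f Q φ) k z (Ici 0))
    (hz : Tendsto z atTop (𝓝ˢ (planarCentroidal (diskDensity f Q φ) n))) :
    Tendsto (fun t i => inverseMap f Q (z t i)) atTop (𝓝ˢ (centroidalConfigs f Q φ n)) := by
  have h1 : Continuous fun (y : Fin n → E2) i => inverseMap f Q (diskProj (y i)) :=
    continuous_pi fun i => hf.continuous_inverseMap_diskProj.comp (continuous_apply i)
  have h2 := h1.tendsto_nhdsSet (s := planarCentroidal (diskDensity f Q φ) n)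
    (t := centroidalConfigs f Q φ n) fun y hy => by
      simp only [diskProj_of_mem (mem_diskConfigs.1 hy.1 _)]
      exact hf.inverseMap_comp_mem_centroidalConfigs hy
  refine (h2.comp hz).congr' ?_
  filter_upwards [eventually_ge_atTop 0] with t ht
  funext i
  simp only [Function.comp, diskProj_of_mem (mem_diskConfigs.1 (h.mem t ht) _)]

end IsConformalDiffeo

end

end SurfaceCoverage

end

/-! ### The main theorem -/

open SurfaceCoverage

theorem mainTheorem1 (Q : Set SurfaceCoverage.E3) (hQ : IsCompact Q)
    (hQs : SurfaceCoverage.IsEmbeddedSurface Q)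
    (f : SurfaceCoverage.E3 → SurfaceCoverage.E2) (hf : SurfaceCoverage.IsConformalDiffeo f Q)
    (φ : SurfaceCoverage.E3 → ℝ) (hφc : ContinuousOn φ Q) (hφ : ∀ q ∈ Q, 0 < φ q)
    (n : ℕ) (k : Fin n → ℝ) (hk : ∀ i, 0 < k i) :
    (∀ P : Fin n → SurfaceCoverage.E3, (∀ i, P i ∈ Q) → Function.Injective P →
      (P ∈ SurfaceCoverage.centroidalConfigs f Q φ n ↔
        HasFDerivWithinAt (SurfaceCoverage.cost f Q φ)
          (0 : (Fin n → SurfaceCoverage.E3) →L[ℝ] ℝ) (Set.univ.pi fun _ => Q) P)) ∧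
    ∀ P₀ : Fin n → SurfaceCoverage.E3, (∀ i, P₀ i ∈ Q) → Function.Injective P₀ →
      ∃ P : ℝ → Fin n → SurfaceCoverage.E3,
        SurfaceCoverage.IsTrajectory f Q φ k P ∧ P 0 = P₀ ∧
        (∀ P' : ℝ → Fin n → SurfaceCoverage.E3,
          SurfaceCoverage.IsTrajectory f Q φ k P' → P' 0 = P₀ → Set.EqOn P' P (Set.Ici 0)) ∧
        (∀ t, 0 ≤ t → Function.Injective (P t)) ∧
        (∀ s t, 0 ≤ s → s < t →
          SurfaceCoverage.cost f Q φ (P t) ≤ SurfaceCoverage.cost f Q φ (P s) ∧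
          (P s ∉ SurfaceCoverage.centroidalConfigs f Q φ n →
            SurfaceCoverage.cost f Q φ (P t) < SurfaceCoverage.cost f Q φ (P s))) ∧
        (∀ i, Tendsto (fun t => f (P t i) - SurfaceCoverage.cellCentroid f Q φ (P t) i)
          atTop (𝓝 0)) ∧
        Tendsto P atTop (𝓝ˢ (SurfaceCoverage.centroidalConfigs f Q φ n)) := by
  have hρ := hf.isDensity_diskDensity hφc hφ
  refine ⟨fun P hP hi => hf.mem_centroidalConfigs_iff_hasFDerivWithinAt hQ hφc hφ hP hi,
    fun P₀ hP₀ hi => ?_⟩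
  have hi₀ := (hf.injective_comp_iff hP₀).2 hi
  obtain ⟨z, hz0, hz⟩ := exists_isPlanarSolution hρ hk (hf.mem_diskConfigs_comp hP₀) hi₀
  have hd : ∀ t, 0 ≤ t → ∀ i, z t i ∈ disk := fun t ht => mem_diskConfigs.1 (hz.mem t ht)
  have hfz : ∀ t, 0 ≤ t → (fun i => f (inverseMap f Q (z t i))) = z t := fun t ht =>
    funext fun i => hf.apply_inverseMap (hd t ht i)
  have hmem : ∀ t, 0 ≤ t → ∀ i, inverseMap f Q (z t i) ∈ Q := fun t ht i =>
    hf.inverseMap_mem (hd t ht i)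
  have hzi : Function.Injective (z 0) := by rwa [hz0]
  have hcost : ∀ t, 0 ≤ t → cost f Q φ (fun i => inverseMap f Q (z t i)) =
      planarCost (diskDensity f Q φ) (z t) := fun t ht => by
    rw [hf.cost_eq_planarCost hQ hφc, hfz t ht]
  refine ⟨fun t i => inverseMap f Q (z t i), hf.isTrajectory hz, ?_, ?_, ?_, ?_, ?_,
    hf.tendsto_nhdsSet_centroidalConfigs hz (hz.tendsto_nhdsSet hρ hk hzi)⟩
  · funext i
    simp only [hz0, hf.inverseMap_apply (hP₀ i)]
  -- Any other trajectory projects to a planar solution with the same initial value, and `f` is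
  -- injective on `Q`.
  · intro P' hP' hP'0 t ht
    have h := (hf.isPlanarSolution hP').eqOn_Ici hρ hk hz
      (by simp only [hP'0, hz0]) (by simpa only [hP'0] using hi₀) ht
    funext i
    have hzt : f (P' t i) = z t i := congrFun h i
    change P' t i = inverseMap f Q (z t i)
    rw [← hzt, hf.inverseMap_apply (hP'.mem t ht i)]
  · intro t ht
    rw [← hf.injective_comp_iff (hmem t ht), hfz t ht]
    exact hz.injective_of_Ici hρ hk hzi ht
  · intro s t hs hst
    rw [hcost s hs, hcost t (hs.trans hst.le), hf.mem_centroidalConfigs_iff (hmem s hs), hfz s hs]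
    exact ⟨hz.planarCost_le hρ hk hzi hs hst.le, hz.planarCost_lt hρ hk hzi hs hst⟩
  · intro i
    refine (hz.tendsto_sub_cellCenter hρ hk hzi i).congr' ?_
    filter_upwards [eventually_ge_atTop 0] with t ht
    rw [hf.apply_inverseMap (hd t ht i)]
    change _ = z t i - cellCenter (diskDensity f Q φ) (fun i => f (inverseMap f Q (z t i))) i
    rw [hfz t ht]
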